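/- **Setting.** An ordered Bratteli diagram $B=(V,E,\preceq)$ has finite vertex levels $V_0=\{v_0\},V_1,V_2,\dots$ and finite edge sets $E_n$ ($n\ge 1$) from $V_{n-1}$ to $V_n$; every vertex of $V_n$ is the end-point of an edge of $E_n$ ($n\ge1$) and the initial point of an edge of $E_{n+1}$ ($n\ge 0$); $\preceq$ is a partial order on the edges for which two edges are comparable iff they have the same end-point. $X_B$ is the space of infinite paths from $v_0$, with the topology generated by cylinder sets. $B$ is properly ordered if there are a unique infinite path $x_{\max}$ with all edges maximal and a unique infinite path $x_{\min}$ with all edges minimal; the Vershik map $V_B$ sends $x_{\max}$ to $x_{\min}$, and, for $x\ne x_{\max}$ with first non-maximal edge $x_n$, replaces $x_n$ by its successor $y_n$ and $(x_1,\dots,x_{n-1})$ by the minimal path from $v_0$ to the initial vertex of $y_n$. A Bratteli–Vershik representation of a dynamical system $(X,T)$ is a properly ordered $B$ with a topological conjugacy from $(X,T)$ to $(X_B,V_B)$. For $x\in X$ let $\tau_n(x)\in V_n$ be the vertex of level $n$ on the path of $x$. The representation is * *proper of rank $d$* if (H1) every vertex of $V_1$ is the end-point of exactly one edge of $E_1$;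 (H2) for $n\ge 2$, each $t_1\in V_{n-1}$ and $t_2\in V_n$ are joined by at least one edge; (H3) $\#V_n=d$ for $n\ge 2$; (H4) for $n\ge 2$ all maximal edges of $E_n$ start at the same vertex. One then identifies $V_n$ with $\{1,\dots,d\}$ for each $n\ge2$ by fixed bijections; * *of Toeplitz type with characteristic sequence $(q_n)_{n\ge 1}$* if for all $n\ge 1$ every vertex of $V_n$ is the end-point of exactly $q_n$ edges of $E_n$. Put $p_n=q_1\cdots q_n$ and $q_{m,n}=q_{m+1}\cdots q_n$ for $m<n$; * *clean* if there are $\delta>0$ and, for every ergodic $T$-invariant Borel probability measure $\mu$, a set $I_\mu\subseteq\{1,\dots,d\}$ such that $\mu(\tau_n=t)\ge\delta$ for all $t\in I_\mu$ and $n\ge 2$, $\lim_{n\to\infty}\mu(\tau_n=t)=0$ for all $t\notin I_\mu$, and $I_\mu\cap I_\nu=\emptyset$ whenever $\mu\neq\nu$ are ergodic. For $m<n$, paths from $V_m$ to $V_n$ are ordered by $(e_{m+1},\dots,e_n)\prec(f_{m+1},\dots,f_n)$ iff for some $i$ one has $e_j=f_j$ for $i<j\le n$ and $e_i\prec f_i$.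 Let $\bar s_{m,n}(x)$ be the number of paths from $V_m$ to $V_n$ that end at $\tau_n(x)$ and are strictly bigger than $(x_{m+1},\dots,x_n)$, and for $t_1\in V_m$, $t_2\in V_n$ let $\bar S_{m,n}(t_1,t_2)=\{\bar s_{m,n}(x): \tau_m(x)=t_1,\ \tau_n(x)=t_2\}$. A number $\lambda\in\mathbb C$ is an eigenvalue of $(X,T)$ for $\mu$ if $f\circ T=\lambda f$ $\mu$-a.e. for some nonzero $f\in L^2(X,\mu)$; it is a continuous eigenvalue if $f\circ T=\lambda f$ for some continuous $f:X\to\mathbb C$, $f\neq0$; a non-continuous eigenvalue for $\mu$ is an eigenvalue for $\mu$ which is not a continuous eigenvalue. **Theorem.** Let $(X,T)$ be a minimal Cantor system (a homeomorphism with all orbits dense on a compact Hausdorff space with a countable basis of clopen sets and no isolated points) with a Toeplitz type, proper and clean Bratteli–Vershik representation of rank $d$ with characteristic sequence $(q_n)_{n\ge1}$, and let $\mu$ be an ergodic $T$-invariant Borel probability measure. Let $a,b$ be coprime integers with $b\ge 1$. Then $\lambda=\exp(2i\pi a/b)$ is a non-continuous eigenvalue of $(X,T)$ for $\mu$ if and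 only if 1. there is an integer $\mathbf b$ with $1<\mathbf b\le d$ such that $b/(b,p_n)=\mathbf b$ for all $n$ large enough, where $(b,p_n)$ is the greatest common divisor, and 2. for all $t_2\in I_\mu$, $$\sum_{t_1\in V_m}\frac{\Bigl|\sum_{s\in\bar S_{m,n}(t_1,t_2)}\lambda^{-p_m s}\Bigr|}{q_{m,n}}\longrightarrow 1\quad\text{as } m,n\to\infty \text{ uniformly in } m<n,$$ that is, for every $\varepsilon>0$ there is $N$ such that the sum differs from $1$ by less than $\varepsilon$ whenever $n>m\ge N$ and $n\ge 2$. -/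

import Mathlib

open MeasureTheory Filter Topology

/-! ### Minimal Cantor systems and their eigenvalues -/

/-- A (nonempty) Cantor set among compact Hausdorff spaces: there is a countable basis of clopen
sets and there are no isolated points. -/
structure IsCantor (X : Type*) [TopologicalSpace X] : Prop where
  nonempty : Nonempty X
  exists_basis : ∃ S : Set (Set X), S.Countable ∧ TopologicalSpace.IsTopologicalBasis S ∧
    ∀ s ∈ S, IsClopen s
  no_isolated : ∀ x : X, ¬ IsOpen ({x} : Set X)

/-- The system `(X, T)` is minimal: all orbits are dense. -/
def IsMinimalSystem {X : Type*} [TopologicalSpace X] (T : X ≃ₜ X) : Prop :=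
  ∀ x : X, Dense (Set.range fun k : ℤ => (T ^ k) x)

/-- `lam` is a continuous eigenvalue of `(X, T)`. -/
def IsContinuousEigenvalue {X : Type*} [TopologicalSpace X] (T : X ≃ₜ X) (lam : ℂ) : Prop :=
  ∃ f : X → ℂ, Continuous f ∧ f ≠ 0 ∧ ∀ x, f (T x) = lam * f x

/-- `lam` is an eigenvalue of `(X, T)` with respect to `μ`: it has a nonzero eigenfunction in
`L²(X, μ)`. -/
def IsMeasurableEigenvalue {X : Type*} [TopologicalSpace X] [MeasurableSpace X] (T : X ≃ₜ X)
    (μ : Measure X) (lam : ℂ) : Prop :=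
  ∃ f : X → ℂ, MemLp f 2 μ ∧ ¬ f =ᵐ[μ] 0 ∧ (fun x => f (T x)) =ᵐ[μ] fun x => lam * f x

/-- `lam` is a non continuous eigenvalue of `(X, T)` for `μ`. -/
def IsNonContinuousEigenvalue {X : Type*} [TopologicalSpace X] [MeasurableSpace X] (T : X ≃ₜ X)
    (μ : Measure X) (lam : ℂ) : Prop :=
  IsMeasurableEigenvalue T μ lam ∧ ¬ IsContinuousEigenvalue T lam

/-! ### Ordered Bratteli diagrams -/

/-- An ordered Bratteli diagram. `V n` is the set of vertices of level `n`, and `E n` is the set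
of edges from `V n` to `V (n + 1)`, which is usually written `E_{n+1}`. Two edges are comparable
if and only if they have the same end-point. -/
structure OrderedBratteliDiagram where
  V : ℕ → Type
  E : ℕ → Type
  [fintypeV : ∀ n, Fintype (V n)]
  [finiteE : ∀ n, Finite (E n)]
  [order : ∀ n, PartialOrder (E n)]
  src : ∀ {n}, E n → V n
  tgt : ∀ {n}, E n → V (n + 1)
  card_V_zero : Nat.card (V 0) = 1
  src_surjective : ∀ n, Function.Surjective (src : E n → V n)
  tgt_surjective : ∀ n, Function.Surjective (tgt : E n → V (n + 1))
  comparable_iff : ∀ {n} (e e' : E n), (e ≤ e' ∨ e' ≤ e) ↔ tgt e = tgt e'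

namespace OrderedBratteliDiagram

attribute [instance] fintypeV finiteE order

variable (B : OrderedBratteliDiagram)

/-- The space `X_B` of infinite paths starting at the unique vertex of level `0`; the coordinate
`x n` is the edge from level `n` to level `n + 1`. -/
@[ext]
structure PathSpace where
  edge : ∀ n, B.E n
  compatible : ∀ n, B.tgt (edge n) = B.src (edge (n + 1))

instance : CoeFun B.PathSpace fun _ => ∀ n, B.E n := ⟨PathSpace.edge⟩

/-- The topology of `X_B` generated by the cylinder sets, that is, the one induced by the product
of the discrete topologies. -/
instance : TopologicalSpace B.PathSpace :=
  TopologicalSpace.induced PathSpace.edge (@Pi.topologicalSpace ℕ B.E fun _ => ⊥)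

/-- The map `τ_n`: the vertex of level `n` through which an infinite path goes (equivalently, the
tower of level `n` to which it belongs). -/
def tau (n : ℕ) (x : B.PathSpace) : B.V n := B.src (x n)

/-- There are exactly one infinite path all of whose edges are maximal and exactly one infinite
path all of whose edges are minimal. -/
def IsProperlyOrdered : Prop :=
  (∃! x : B.PathSpace, ∀ n, IsMax (x n)) ∧ ∃! x : B.PathSpace, ∀ n, IsMin (x n)

/-- `y` is the image of `x` under the Vershik map. If all edges of `x` are maximal then all edges
of `y` are minimal; if `n` is the first index such that `x n` is not maximal, then `y n` is the
successor of `x n`, `y` is minimal before `n` and agrees with `x` after `n`. -/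
def IsVershikImage (x y : B.PathSpace) : Prop :=
  ((∀ n, IsMax (x n)) → ∀ n, IsMin (y n)) ∧
  ∀ n, (∀ i < n, IsMax (x i)) → ¬ IsMax (x n) →
    x n ⋖ y n ∧ (∀ i < n, IsMin (y i)) ∧ ∀ i, n < i → y i = x i

variable {B}

theorem exists_isMin_tgt {n : ℕ} (v : B.V (n + 1)) : ∃ e : B.E n, IsMin e ∧ B.tgt e = v := by
  obtain ⟨e, he⟩ := B.tgt_surjective n v
  obtain ⟨m, hm, hmin⟩ := Finite.exists_le_minimal (p := fun _ : B.E n => True) (a := e) trivial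
  refine ⟨m, fun y hy => hmin.2 trivial hy, ?_⟩
  rw [← he]
  exact (B.comparable_iff _ _).1 (Or.inl hm)

theorem eq_of_isMin {n : ℕ} {e e' : B.E n} (h : IsMin e) (h' : IsMin e')
    (ht : B.tgt e = B.tgt e') : e = e' := by
  rcases (B.comparable_iff e e').2 ht with hle | hle
  · exact le_antisymm hle (h' hle)
  · exact le_antisymm (h hle) hle

theorem eq_of_covBy {n : ℕ} {e f f' : B.E n} (h : e ⋖ f) (h' : e ⋖ f') : f = f' := by
  have ht : B.tgt f = B.tgt f' :=
    ((B.comparable_iff _ _).1 (Or.inl h.le)).symm.trans ((B.comparable_iff _ _).1 (Or.inl h'.le))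
  rcases (B.comparable_iff f f').2 ht with hle | hle
  · exact hle.eq_or_lt.elim id fun hlt => absurd hlt (h'.2 h.lt)
  · exact (hle.eq_or_lt.elim id fun hlt => absurd hlt (h.2 h'.lt)).symm

theorem exists_minimal_prefix (hne : ∀ i, Nonempty (B.E i)) (n : ℕ) (e : B.E n) :
    ∃ f : ∀ i, B.E i, f n = e ∧ ∀ i < n, B.tgt (f i) = B.src (f (i + 1)) ∧ IsMin (f i) := by
  classical
  induction n with
  | zero =>
    exact ⟨Function.update (fun i => (hne i).some) 0 e, by simp, fun i hi => absurd hi (by simp)⟩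
  | succ n ih =>
    obtain ⟨e₀, hmin, ht⟩ := exists_isMin_tgt (B.src e)
    obtain ⟨f, hf, hf'⟩ := ih e₀
    refine ⟨Function.update f (n + 1) e, by simp, fun i hi => ?_⟩
    rcases Nat.lt_succ_iff_lt_or_eq.1 hi with h | rfl
    · rw [Function.update_of_ne (by omega), Function.update_of_ne (by omega)]
      exact hf' i h
    · rw [Function.update_of_ne (by omega), Function.update_self, hf]
      exact ⟨ht, hmin⟩

/-- The Vershik map is well defined. -/
theorem existsUnique_vershikImage (hB : B.IsProperlyOrdered) (x : B.PathSpace) :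
    ∃! y : B.PathSpace, B.IsVershikImage x y := by
  classical
  by_cases hx : ∀ n, IsMax (x n)
  · obtain ⟨y, hy, huniq⟩ := hB.2
    exact ⟨y, ⟨fun _ => hy, fun n _ hn => absurd (hx n) hn⟩, fun z hz => huniq z (hz.1 hx)⟩
  · have hex : ∃ n, ¬ IsMax (x n) := not_forall.1 hx
    obtain ⟨n, hn, hlt⟩ : ∃ n, ¬ IsMax (x n) ∧ ∀ i < n, IsMax (x i) :=
      ⟨Nat.find hex, Nat.find_spec hex, fun i hi => not_not.1 (Nat.find_min hex hi)⟩
    obtain ⟨g, hg⟩ := not_isMax_iff.1 hn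
    obtain ⟨e, hle, hmin⟩ := Finite.exists_le_minimal (p := fun e : B.E n => x n < e) hg
    have hcov : x n ⋖ e := ⟨hmin.1, fun c hc hce => hce.not_ge (hmin.2 hc hce.le)⟩
    have het : B.tgt (x n) = B.tgt e := (B.comparable_iff _ _).1 (Or.inl hcov.le)
    obtain ⟨f, hf, hf'⟩ := exists_minimal_prefix (fun i => ⟨x i⟩) n e
    have hpath : ∀ i, B.tgt (if i ≤ n then f i else x i) =
        B.src (if i + 1 ≤ n then f (i + 1) else x (i + 1)) := by
      intro i
      rcases lt_trichotomy i n with h | h | h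
      · rw [if_pos h.le, if_pos (Nat.succ_le_of_lt h)]
        exact (hf' i h).1
      · subst h
        rw [if_pos le_rfl, if_neg (by omega), hf, ← het]
        exact x.compatible i
      · rw [if_neg (by omega), if_neg (by omega)]
        exact x.compatible i
    have key : ∀ k, (∀ i < k, IsMax (x i)) → ¬ IsMax (x k) → k = n := by
      intro k hk hk'
      rcases lt_trichotomy k n with h | h | h
      · exact absurd (hlt k h) hk'
      · exact h
      · exact absurd (hk n h) hn
    refine ⟨⟨fun i => if i ≤ n then f i else x i, hpath⟩, ⟨fun h => absurd h hx, ?_⟩, ?_⟩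
    · intro k hk hk'
      obtain rfl := key k hk hk'
      refine ⟨?_, fun i hi => ?_, fun i hi => ?_⟩
      · change x k ⋖ (if k ≤ k then f k else x k)
        rw [if_pos le_rfl, hf]
        exact hcov
      · change IsMin (if i ≤ k then f i else x i)
        rw [if_pos hi.le]
        exact (hf' i hi).2
      · exact if_neg (by omega)
    · intro z hz
      obtain ⟨h1, h2, h3⟩ := hz.2 n hlt hn
      have hzn : z n = e := eq_of_covBy h1 hcov
      have hdown : ∀ k i, i + k = n → z i = f i := by
        intro k
        induction k with
        | zero =>
          intro i hi
          obtain rfl : i = n := by omega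
          rw [hzn, hf]
        | succ k ih =>
          intro i hi
          have hin : i < n := by omega
          refine eq_of_isMin (h2 i hin) (hf' i hin).2 ?_
          rw [z.compatible i, (hf' i hin).1, ← ih (i + 1) (by omega)]
      refine PathSpace.ext (funext fun i => ?_)
      change z i = if i ≤ n then f i else x i
      split_ifs with h
      · exact hdown (n - i) i (by omega)
      · exact h3 i (by omega)

/-- The Vershik map `V_B : X_B → X_B` of a properly ordered Bratteli diagram. -/
noncomputable def vershik (hB : B.IsProperlyOrdered) (x : B.PathSpace) : B.PathSpace :=
  (existsUnique_vershikImage hB x).choose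

variable (B)

/-- The incidence matrix between the levels `n` and `n + 1`. -/
noncomputable def incidence (n : ℕ) (t₁ : B.V n) (t₂ : B.V (n + 1)) : ℕ :=
  Nat.card {e : B.E n // B.src e = t₁ ∧ B.tgt e = t₂}

/-- The conditions (H1), (H2), (H3), (H4) defining a proper representation of rank `d`: every
vertex of level `1` is reached by a single edge; the incidence matrices of the levels at least `2`
are positive; all levels `n ≥ 2` have `d` vertices; for every `n ≥ 2` all maximal edges that end
at level `n` start at the same vertex of level `n - 1`. -/
structure IsProper (d : ℕ) : Prop where
  h1 : ∀ (v : B.V 0) (t : B.V 1), B.incidence 0 v t = 1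
  h2 : ∀ n, 1 ≤ n → ∀ (t₁ : B.V n) (t₂ : B.V (n + 1)), 0 < B.incidence n t₁ t₂
  h3 : ∀ n, 2 ≤ n → Nat.card (B.V n) = d
  h4 : ∀ n, 1 ≤ n → ∀ e e' : B.E n, IsMax e → IsMax e' → B.src e = B.src e'

/-- The diagram is of Toeplitz type with characteristic sequence `(q n ; n ≥ 1)`: every vertex of
level `n` is the end-point of exactly `q n` edges (the value `q 0` plays no role). -/
def IsToeplitz (q : ℕ → ℕ) : Prop :=
  ∀ n (t : B.V (n + 1)), Nat.card {e : B.E n // B.tgt e = t} = q (n + 1)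

/-- The set `E_{m,n}` of paths from level `m` to level `n`. -/
structure FinPath (m n : ℕ) where
  edge : ∀ i, m ≤ i → i < n → B.E i
  compatible : ∀ i (h : m ≤ i) (h' : i + 1 < n),
    B.tgt (edge i h (Nat.lt_of_succ_lt h')) = B.src (edge (i + 1) (Nat.le_succ_of_le h) h')

variable {B}

/-- The strict order induced on `E_{m,n}`: the last edge in which two paths differ decides. -/
def FinPath.Lt {m n : ℕ} (e f : B.FinPath m n) : Prop :=
  ∃ i, ∃ (h : m ≤ i) (h' : i < n), e.edge i h h' < f.edge i h h' ∧
    ∀ j (hij : i < j) (hj : j < n),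
      e.edge j (h.trans hij.le) hj = f.edge j (h.trans hij.le) hj

/-- The segment of the infinite path `x` between the levels `m` and `n`. -/
def PathSpace.segment (x : B.PathSpace) (m n : ℕ) : B.FinPath m n where
  edge i _ _ := x i
  compatible i _ _ := x.compatible i

variable (B)

/-- For `m < n`, the number `s̄_{m,n}(x)` of paths in `E_{m,n}` which end at `τ_n(x)`, the
end-point of the last edge of the segment of `x`, and are strictly bigger than this segment. -/
noncomputable def suffix (m n : ℕ) (x : B.PathSpace) : ℕ :=
  Nat.card {g : B.FinPath m n // (x.segment m n).Lt g ∧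
    ∀ i (h : m ≤ i) (h' : i < n), i + 1 = n → B.tgt (g.edge i h h') = B.tgt (x i)}

/-- The set `S̄_{m,n}(t₁, t₂)`. -/
def suffixSet (m n : ℕ) (t₁ : B.V m) (t₂ : B.V n) : Set ℕ :=
  {s | ∃ x : B.PathSpace, B.tau m x = t₁ ∧ B.tau n x = t₂ ∧ B.suffix m n x = s}

/-- `(X_B, V_B)` is a Bratteli-Vershik representation of `(X, T)`: the diagram `B` is properly
ordered and `(X, T)` is topologically conjugate to `(X_B, V_B)`. -/
structure Representation {X : Type*} [TopologicalSpace X] (T : X ≃ₜ X) where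
  properlyOrdered : B.IsProperlyOrdered
  conj : X ≃ₜ B.PathSpace
  conj_apply : ∀ x, conj (T x) = B.vershik properlyOrdered (conj x)

variable {B}

/-- The diagram is clean, with `I μ` the set of vertices attached to the ergodic measure `μ`. The
vertices of each level `n ≥ 2` are identified with `{1, …, d}` by `vtx n`. -/
def Representation.IsClean {X : Type*} [TopologicalSpace X] [MeasurableSpace X] {T : X ≃ₜ X}
    (R : B.Representation T) {d : ℕ} (vtx : ∀ n, 2 ≤ n → Fin d ≃ B.V n)
    (I : Measure X → Set (Fin d)) : Prop :=
  ∃ δ : ℝ, 0 < δ ∧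
    (∀ μ : Measure X, IsProbabilityMeasure μ → Ergodic T μ →
      (∀ t ∈ I μ, ∀ n (hn : 2 ≤ n), δ ≤ μ.real {x | B.tau n (R.conj x) = vtx n hn t}) ∧
      ∀ t ∉ I μ, Tendsto
        (fun n => μ.real {x | B.tau (n + 2) (R.conj x) = vtx (n + 2) (Nat.le_add_left 2 n) t})
        atTop (𝓝 0)) ∧
    ∀ μ ν : Measure X, IsProbabilityMeasure μ → Ergodic T μ → IsProbabilityMeasure ν →
      Ergodic T ν → μ ≠ ν → Disjoint (I μ) (I ν)

end OrderedBratteliDiagram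

/-- `q_{m,n} = q_{m+1} ⋯ q_n`. -/
def qProd (q : ℕ → ℕ) (m n : ℕ) : ℕ := ∏ i ∈ Finset.Ioc m n, q i

/-- `p_n = q_1 ⋯ q_n`. -/
def pSeq (q : ℕ → ℕ) (n : ℕ) : ℕ := qProd q 0 n

/-! Write s_n for `suffix 0 n` and s_{m,n} for `suffix m n`. In the Toeplitz case s_n is a
mixed-radix number with digits `numAbove (x i)` and bases q_{i+1}, so s_n = s_m + p_m s_{m,n}. The
Vershik map lowers s_n by one until it reaches 0 and then resets it to p_n - 1. Hence level n gives
towers of common height p_n, and T^{p_n} preserves s_n, though it may change the tower.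

Continuity. By (H4), T^{p_n} moves the point with maximal path very little when n is large. A
continuous eigenfunction does not vanish there, so λ^{p_n} is close to 1, and being a b-th root of
unity it equals 1. Conversely, if b divides p_n then λ^{-s_n} is a continuous eigenfunction. Thus λ
is a continuous eigenvalue iff b divides some p_n (`isContinuousEigenvalue_iff`).

Necessity. Let f be an eigenfunction of modulus one. The function F_m = λ^{s_m} f is constant along
the towers of level m, so approximating f by continuous functions makes F_m close in L¹ to a
function c(τ_m) (`exists_tower_approx`). Since T^{p_m} preserves μ and multiplies F_m by λ^{p_m}, a
primitive root of unity of order r = b/(b,p_m), a small ball around a value of c has F_m-mass at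
most 1/r. As d such balls carry almost all the mass, r ≤ d (`le_of_rotation_invariant`). For the
sums, F_n = λ^{p_m s_{m,n}} F_m is compared on a tower t₂ of level n with λ^{p_m s_{m,n}} c(τ_m).
Given t₂, s_{m,n} is uniformly distributed (`setIntegral_suffix`), so the integral is bounded by the
exponential sums, while its modulus is almost μ(τ_n = t₂) (`exists_forall_sum_norm_ge`). Cleanness
bounds this measure below.

Sufficiency. The functions g_{n,t} = 1_{τ_n=t} λ^{-s_n} satisfy g∘T = λg off a set of measure 1/p_n.
If λ were not an eigenvalue, von Neumann's mean ergodic theorem would force g_{n,t₂} → 0 weakly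
(`tendsto_inner_zero_of_almost_fixed`). But its inner products with the g_{m,t₁} are, in modulus,
the terms of the exponential sum times μ(τ_n = t₂)/q_{m,n}, and these do not all become small
(`isMeasurableEigenvalue_of_le_sum`). -/

theorem Nat.card_subtype_comp_eq_mul {G E : Type*} [Finite G] [Finite E] (φ : G → E) (P : E → Prop)
    (k : ℕ) (h : ∀ e, P e → Nat.card {g // φ g = e} = k) :
    Nat.card {g // P (φ g)} = Nat.card {e // P e} * k := by
  have := Fintype.ofFinite {e // P e}
  rw [← Nat.card_congr (Equiv.sigmaSubtypeFiberEquivSubtype φ (p := fun g => P (φ g)) (q := P)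
    fun _ => Iff.rfl), Nat.card_sigma, Finset.sum_congr rfl fun e _ => h e.1 e.2]
  simp [Nat.card_eq_fintype_card]

theorem qProd_self (q : ℕ → ℕ) (m : ℕ) : qProd q m m = 1 := by simp [qProd]

theorem qProd_succ (q : ℕ → ℕ) {m n : ℕ} (h : m ≤ n) :
    qProd q m (n + 1) = qProd q m n * q (n + 1) := by
  rw [qProd, qProd, ← Finset.insert_Ioc_right_eq_Ioc_add_one h, Finset.prod_insert (by simp),
    mul_comm]

theorem pSeq_succ (q : ℕ → ℕ) (n : ℕ) : pSeq q (n + 1) = pSeq q n * q (n + 1) :=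
  qProd_succ q n.zero_le

theorem pSeq_mul_qProd (q : ℕ → ℕ) {m n : ℕ} (h : m ≤ n) :
    pSeq q m * qProd q m n = pSeq q n := by
  induction n, h using Nat.le_induction with
  | base => simp [qProd_self]
  | succ n hmn ih => rw [qProd_succ q hmn, ← mul_assoc, ih, pSeq_succ]

/-! ### Counting and ordering finite paths. -/

namespace OrderedBratteliDiagram

variable {B : OrderedBratteliDiagram}

namespace FinPath

@[ext]
theorem ext {m n : ℕ} {g g' : B.FinPath m n}
    (h : ∀ i (hi : m ≤ i) (hi' : i < n), g.edge i hi hi' = g'.edge i hi hi') : g = g' := by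
  cases g; cases g'
  congr
  funext i hi hi'
  exact h i hi hi'

instance instFinite (m n : ℕ) : Finite (B.FinPath m n) := by
  refine Finite.of_injective
    (fun (g : B.FinPath m n) (i : {i : Fin n // m ≤ i}) => g.edge i i.2 i.1.2) fun g g' h => ?_
  ext i hi hi'
  exact congrFun h ⟨⟨i, hi'⟩, hi⟩

/-- The last edge of a path. -/
def last {m n : ℕ} (hmn : m ≤ n) (g : B.FinPath m (n + 1)) : B.E n := g.edge n hmn n.lt_succ_self

/-- The path without its last edge. -/
def init {m n : ℕ} (g : B.FinPath m (n + 1)) : B.FinPath m n where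
  edge i h h' := g.edge i h (Nat.lt_succ_of_lt h')
  compatible i h h' := g.compatible i h (Nat.lt_succ_of_lt h')

theorem ext_init_last {m n : ℕ} (hmn : m ≤ n) {g g' : B.FinPath m (n + 1)}
    (hi : g.init = g'.init) (hl : g.last hmn = g'.last hmn) : g = g' := by
  ext i h h'
  rcases Nat.lt_succ_iff_lt_or_eq.1 h' with h'' | rfl
  · exact congrArg (fun g : B.FinPath m n => g.edge i h h'') hi
  · exact hl

/-- The path extended by one edge. -/
def snoc {m n : ℕ} (hmn : m ≤ n) (g : B.FinPath m (n + 1)) (e : B.E (n + 1))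
    (he : B.tgt (g.last hmn) = B.src e) : B.FinPath m (n + 2) where
  edge i h h' := if hi : i < n + 1 then g.edge i h hi else
    (Nat.eq_of_lt_succ_of_not_lt h' hi) ▸ e
  compatible i h h' := by
    have hi : i < n + 1 := by omega
    rcases Nat.lt_succ_iff_lt_or_eq.1 hi with h'' | rfl
    · rw [dif_pos hi, dif_pos (by omega)]
      exact g.compatible i h (by omega)
    · rw [dif_pos hi, dif_neg (by omega)]
      exact he

/-- Paths with last edge `e` correspond to shorter paths ending at the source of `e`. -/
def initEquiv {m n : ℕ} (hmn : m ≤ n) (e : B.E (n + 1)) :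
    {g : B.FinPath m (n + 2) // g.last (hmn.trans n.le_succ) = e} ≃
      {g : B.FinPath m (n + 1) // B.tgt (g.last hmn) = B.src e} where
  toFun g := ⟨g.1.init,
    (g.1.compatible n hmn (Nat.lt_succ_self _)).trans (congrArg B.src g.2)⟩
  invFun g := ⟨g.1.snoc hmn e g.2, by simp [last, snoc]⟩
  left_inv g := by
    refine Subtype.ext (ext_init_last (hmn.trans n.le_succ) ?_ ?_)
    · ext i h h'
      exact dif_pos h'
    · simp [last, snoc, ← g.2]
  right_inv g := by
    refine Subtype.ext ?_
    ext i h h'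
    exact dif_pos h'

/-- Half of an alternating induction with `card_last_eq`: the count for fixed last edges is assumed,
and the q_{n+1} edges into the vertex are summed over. -/
theorem card_tgt_last {q : ℕ → ℕ} (hq : B.IsToeplitz q) {m n : ℕ} (hmn : m ≤ n)
    (h : ∀ e : B.E n, Nat.card {g : B.FinPath m (n + 1) // g.last hmn = e} = qProd q m n)
    (v : B.V (n + 1)) :
    Nat.card {g : B.FinPath m (n + 1) // B.tgt (g.last hmn) = v} = qProd q m (n + 1) := by
  rw [Nat.card_subtype_comp_eq_mul (last hmn) (fun e => B.tgt e = v) _ fun e _ => h e, hq,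
    qProd_succ q hmn, mul_comm]

theorem card_last_eq {q : ℕ → ℕ} (hq : B.IsToeplitz q) {m n : ℕ} (hmn : m ≤ n) (e : B.E n) :
    Nat.card {g : B.FinPath m (n + 1) // g.last hmn = e} = qProd q m n := by
  induction n, hmn using Nat.le_induction with
  | base =>
    rw [qProd_self, Nat.card_eq_one_iff_unique]
    refine ⟨⟨fun g g' => Subtype.ext (ext_init_last le_rfl ?_ (g.2.trans g'.2.symm))⟩, ⟨⟨⟨fun i h h' =>
      (le_antisymm h (Nat.le_of_lt_succ h')) ▸ e, fun i h h' => by omega⟩, rfl⟩⟩⟩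
    ext i h h'
    omega
  | succ n hmn ih =>
    rw [Nat.card_congr (initEquiv hmn e), card_tgt_last hq hmn ih]

/-- The last edge is the most significant digit of the order. -/
theorem lt_iff {m n : ℕ} (hmn : m ≤ n) {g g' : B.FinPath m (n + 1)} :
    g.Lt g' ↔ g.last hmn < g'.last hmn ∨ g.last hmn = g'.last hmn ∧ g.init.Lt g'.init := by
  constructor
  · rintro ⟨i, h, h', hlt, heq⟩
    rcases Nat.lt_succ_iff_lt_or_eq.1 h' with h'' | rfl
    · exact Or.inr ⟨heq n h'' n.lt_succ_self, i, h, h'', hlt, fun j hij hj => heq j hij (by omega)⟩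
    · exact Or.inl hlt
  · rintro (h | ⟨h, i, hi, hi', hlt, heq⟩)
    · exact ⟨n, hmn, n.lt_succ_self, h, fun j hj hj' => by omega⟩
    · refine ⟨i, hi, by omega, hlt, fun j hij hj => ?_⟩
      rcases Nat.lt_succ_iff_lt_or_eq.1 hj with h'' | rfl
      · exact heq j hij h''
      · exact h

end FinPath

/-! ### Suffix numbers as mixed-radix expansions. -/

/-- The number of edges that are bigger than `e`. -/
noncomputable def numAbove {n : ℕ} (e : B.E n) : ℕ := Nat.card {f : B.E n // e < f}

theorem suffix_self (m : ℕ) (x : B.PathSpace) : B.suffix m m x = 0 := by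
  rw [suffix, Nat.card_eq_zero]
  refine Or.inl ⟨fun g => ?_⟩
  obtain ⟨i, h, h', -⟩ := g.2.1
  omega

theorem suffix_succ_eq_card {m n : ℕ} (hmn : m ≤ n) (x : B.PathSpace) :
    B.suffix m (n + 1) x = Nat.card {g : B.FinPath m (n + 1) //
      (x.segment m (n + 1)).Lt g ∧ B.tgt (g.last hmn) = B.tgt (x n)} := by
  refine Nat.card_congr (Equiv.subtypeEquivRight fun g => and_congr_right fun _ => ?_)
  constructor
  · exact fun h => h n hmn n.lt_succ_self rfl
  · rintro h i hi hi' hin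
    obtain rfl : i = n := by omega
    exact h

theorem card_lt_last_eq {m n : ℕ} (hmn : m ≤ n) (x : B.PathSpace) :
    Nat.card {g : B.FinPath m (n + 1) //
      g.last hmn = x n ∧ (x.segment m n).Lt g.init} = B.suffix m n x := by
  -- Paths of length zero have no last edge, so `initEquiv` only covers the case `m < n`.
  rcases hmn.eq_or_lt with rfl | hlt
  · rw [suffix_self, Nat.card_eq_zero]
    refine Or.inl ⟨fun g => ?_⟩
    obtain ⟨i, h, h', -⟩ := g.2.2
    omega
  obtain ⟨k, rfl⟩ : ∃ k, n = k + 1 := ⟨n - 1, by omega⟩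
  have hmk : m ≤ k := by omega
  rw [suffix_succ_eq_card hmk]
  refine Nat.card_congr ((Equiv.subtypeSubtypeEquivSubtypeInter _ _).symm.trans
    (((FinPath.initEquiv hmk (x (k + 1))).subtypeEquiv (q := fun g =>
      (x.segment m (k + 1)).Lt g.1) fun g => Iff.rfl).trans
    ((Equiv.subtypeSubtypeEquivSubtypeInter _ _).trans (Equiv.subtypeEquivRight fun g => ?_))))
  rw [x.compatible k, and_comm]

/-- A bigger path either shares the last edge and is bigger before it, or has one of the `numAbove
(x n)` bigger last edges and an arbitrary beginning. Each such edge admits q_{m,n} beginnings,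
whatever its source; this is where the Toeplitz condition enters. -/
theorem suffix_succ {q : ℕ → ℕ} (hq : B.IsToeplitz q) {m n : ℕ} (hmn : m ≤ n) (x : B.PathSpace) :
    B.suffix m (n + 1) x = B.suffix m n x + qProd q m n * numAbove (x n) := by
  classical
  rw [suffix_succ_eq_card hmn, ← card_lt_last_eq hmn x, numAbove, mul_comm,
    ← Nat.card_subtype_comp_eq_mul (FinPath.last hmn) (fun e => x n < e) _
      fun e _ => FinPath.card_last_eq hq hmn e, ← Nat.card_sum]
  refine Nat.card_congr ((Equiv.subtypeEquivRight fun g => ?_).trans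
    (subtypeOrEquiv _ _ ?_))
  · rw [FinPath.lt_iff hmn]
    constructor
    · rintro ⟨h | h, -⟩
      · exact Or.inr h
      · exact Or.inl ⟨h.1.symm, h.2⟩
    · rintro (⟨h, h'⟩ | h)
      · exact ⟨Or.inr ⟨h.symm, h'⟩, by rw [h]⟩
      · exact ⟨Or.inl h, ((B.comparable_iff _ _).1 (Or.inl h.le)).symm⟩
  · rw [Pi.disjoint_iff]
    intro g
    rw [Prop.disjoint_iff]
    by_contra h
    exact h.2.ne h.1.1.symm

theorem numAbove_eq_zero_iff {n : ℕ} {e : B.E n} : numAbove e = 0 ↔ IsMax e := by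
  rw [numAbove, Nat.card_eq_zero, or_iff_left (by simpa using inferInstanceAs (Finite {f // e < f}))]
  constructor
  · intro h f hf
    by_contra hfe
    exact h.false ⟨f, lt_of_le_not_ge hf hfe⟩
  · exact fun h => ⟨fun f => h.not_lt f.2⟩

theorem tgt_eq_of_lt {n : ℕ} {e f : B.E n} (h : e < f) : B.tgt e = B.tgt f :=
  (B.comparable_iff _ _).1 (Or.inl h.le)

theorem numAbove_strictAnti {n : ℕ} {e f : B.E n} (h : e < f) : numAbove f < numAbove e :=
  Set.ncard_lt_ncard (s := {g | f < g}) (t := {g | e < g})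
    ⟨fun _ hg => h.trans hg, fun hs => lt_irrefl f (hs h)⟩ (Set.toFinite _)

theorem eq_of_numAbove_eq {n : ℕ} {e f : B.E n} (ht : B.tgt e = B.tgt f)
    (h : numAbove e = numAbove f) : e = f := by
  rcases (B.comparable_iff e f).2 ht with hle | hle
  · exact hle.eq_or_lt.elim id fun hlt => absurd h (numAbove_strictAnti hlt).ne'
  · exact (hle.eq_or_lt.elim id fun hlt => absurd h (numAbove_strictAnti hlt).ne).symm

theorem numAbove_lt {q : ℕ → ℕ} (hq : B.IsToeplitz q) {n : ℕ} (e : B.E n) :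
    numAbove e < q (n + 1) := by
  rw [← hq n (B.tgt e)]
  exact Set.ncard_lt_ncard (s := {g | e < g}) (t := {g | B.tgt g = B.tgt e})
    ⟨fun _ hg => (tgt_eq_of_lt hg).symm, fun hs => lt_irrefl e (hs rfl)⟩ (Set.toFinite _)

theorem numAbove_of_isMin {q : ℕ → ℕ} (hq : B.IsToeplitz q) {n : ℕ} {e : B.E n} (he : IsMin e) :
    numAbove e + 1 = q (n + 1) := by
  have hset : {g : B.E n | B.tgt g = B.tgt e} = insert e {g | e < g} := by
    ext g
    simp only [Set.mem_ofPred_eq, Set.mem_insert_iff]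
    constructor
    · intro h
      rcases (B.comparable_iff g e).2 h with hle | hle
      · exact Or.inl (le_antisymm hle (he hle))
      · exact (hle.eq_or_lt).imp Eq.symm id
    · rintro (rfl | h)
      · rfl
      · exact (tgt_eq_of_lt h).symm
  rw [← hq n (B.tgt e)]
  change _ = Set.ncard {g : B.E n | B.tgt g = B.tgt e}
  rw [hset, Set.ncard_insert_of_notMem (by simp) (Set.toFinite _)]
  rfl

theorem numAbove_covBy {n : ℕ} {e f : B.E n} (h : e ⋖ f) : numAbove f + 1 = numAbove e := by
  have hset : {g : B.E n | e < g} = insert f {g | f < g} := by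
    ext g
    simp only [Set.mem_ofPred_eq, Set.mem_insert_iff]
    constructor
    · intro hg
      rcases (B.comparable_iff g f).2 ((tgt_eq_of_lt hg).symm.trans (tgt_eq_of_lt h.lt)) with
        hle | hle
      · exact Or.inl (hle.eq_or_lt.elim id fun hlt => absurd hlt (h.2 hg))
      · exact (hle.eq_or_lt).imp Eq.symm id
    · rintro (rfl | hg)
      · exact h.lt
      · exact h.lt.trans hg
  change _ = Set.ncard {g : B.E n | e < g}
  rw [hset, Set.ncard_insert_of_notMem (by simp) (Set.toFinite _)]
  rfl

theorem suffix_lt {q : ℕ → ℕ} (hq : B.IsToeplitz q) {m n : ℕ} (hmn : m ≤ n) (x : B.PathSpace) :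
    B.suffix m n x < qProd q m n := by
  induction n, hmn using Nat.le_induction with
  | base => simp [suffix_self, qProd_self]
  | succ n hmn ih =>
    rw [suffix_succ hq hmn, qProd_succ q hmn]
    calc _ < qProd q m n * (numAbove (x n) + 1) := by rw [mul_add_one]; omega
      _ ≤ _ := Nat.mul_le_mul_left _ (numAbove_lt hq _)

theorem suffix_zero_eq {q : ℕ → ℕ} (hq : B.IsToeplitz q) {m n : ℕ} (hmn : m ≤ n)
    (x : B.PathSpace) : B.suffix 0 n x = B.suffix 0 m x + pSeq q m * B.suffix m n x := by
  induction n, hmn using Nat.le_induction with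
  | base => simp [suffix_self]
  | succ n hmn ih =>
    rw [suffix_succ hq n.zero_le, suffix_succ hq hmn, ih, mul_add, ← mul_assoc,
      pSeq_mul_qProd q hmn, add_assoc]
    rfl

/-- The end-point and the suffix of a segment determine the segment. -/
theorem eq_of_suffix_eq {q : ℕ → ℕ} (hq : B.IsToeplitz q) {m n : ℕ} (hmn : m ≤ n)
    {x y : B.PathSpace} (ht : B.tau n x = B.tau n y) (hs : B.suffix m n x = B.suffix m n y) :
    B.tau m x = B.tau m y ∧ ∀ i, m ≤ i → i < n → x i = y i := by
  induction n, hmn using Nat.le_induction with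
  | base => exact ⟨ht, fun i h h' => by omega⟩
  | succ n hmn ih =>
    have hpos := (Nat.zero_le _).trans_lt (suffix_lt hq hmn x)
    rw [suffix_succ hq hmn, suffix_succ hq hmn] at hs
    have hmod := congrArg (· % qProd q m n) hs
    have hdiv := congrArg (· / qProd q m n) hs
    -- Remainder and quotient by q_{m,n} recover the lower digits and the last digit.
    simp only [Nat.add_mul_mod_self_left, Nat.mod_eq_of_lt (suffix_lt hq hmn _),
      Nat.add_mul_div_left _ _ hpos, Nat.div_eq_of_lt (suffix_lt hq hmn _), zero_add] at hmod hdiv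
    have hn : x n = y n := by
      refine eq_of_numAbove_eq ?_ hdiv
      rw [x.compatible, y.compatible]
      exact ht
    obtain ⟨h1, h2⟩ := ih (congrArg B.src hn) hmod
    refine ⟨h1, fun i hi hi' => ?_⟩
    rcases Nat.lt_succ_iff_lt_or_eq.1 hi' with h | rfl
    · exact h2 i hi h
    · exact hn

theorem suffix_congr {m n : ℕ} {x y : B.PathSpace} {q : ℕ → ℕ} (hq : B.IsToeplitz q) (hmn : m ≤ n)
    (h : ∀ i, m ≤ i → i < n → x i = y i) : B.suffix m n x = B.suffix m n y := by
  induction n, hmn using Nat.le_induction with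
  | base => simp [suffix_self]
  | succ n hmn ih =>
    rw [suffix_succ hq hmn, suffix_succ hq hmn, ih fun i hi hi' => h i hi (by omega),
      h n hmn n.lt_succ_self]

theorem suffix_zero_eq_zero_iff {q : ℕ → ℕ} (hq : B.IsToeplitz q) {n : ℕ} {x : B.PathSpace} :
    B.suffix 0 n x = 0 ↔ ∀ i < n, IsMax (x i) := by
  induction n with
  | zero => simp [suffix_self]
  | succ n ih =>
    have hpos := (Nat.zero_le _).trans_lt (suffix_lt hq n.zero_le x)
    rw [suffix_succ hq n.zero_le, Nat.add_eq_zero_iff, ih, Nat.mul_eq_zero, or_iff_right hpos.ne',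
      numAbove_eq_zero_iff]
    constructor
    · rintro ⟨h, h'⟩ i hi
      rcases Nat.lt_succ_iff_lt_or_eq.1 hi with h'' | rfl
      · exact h i h''
      · exact h'
    · exact fun h => ⟨fun i hi => h i (by omega), h n n.lt_succ_self⟩

theorem suffix_of_isMin {q : ℕ → ℕ} (hq : B.IsToeplitz q) {n : ℕ} {x : B.PathSpace}
    (h : ∀ i < n, IsMin (x i)) : B.suffix 0 n x + 1 = pSeq q n := by
  induction n with
  | zero => simp [suffix_self, pSeq, qProd_self]
  | succ n ih =>
    have := numAbove_of_isMin hq (h n n.lt_succ_self)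
    rw [suffix_succ hq n.zero_le, pSeq_succ, ← this, mul_add_one,
      ← ih fun i hi => h i (by omega)]
    change _ + pSeq q n * _ + 1 = _
    rw [← ih fun i hi => h i (by omega)]
    ring

/-! ### The Vershik map as a countdown of the suffix number. -/

theorem IsVershikImage.suffix_of_pos {q : ℕ → ℕ} (hq : B.IsToeplitz q) {n : ℕ} {x y : B.PathSpace}
    (h : B.IsVershikImage x y) (hs : 0 < B.suffix 0 n x) :
    B.suffix 0 n y + 1 = B.suffix 0 n x ∧ B.tau n y = B.tau n x := by
  classical
  have hex : ∃ i, i < n ∧ ¬ IsMax (x i) := by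
    by_contra! hcon
    exact hs.ne' ((suffix_zero_eq_zero_iff hq).2 hcon)
  obtain ⟨k, ⟨hkn, hk⟩, hlt⟩ : ∃ k, (k < n ∧ ¬ IsMax (x k)) ∧ ∀ i < k, IsMax (x i) := by
    refine ⟨Nat.find hex, Nat.find_spec hex, fun i hi => ?_⟩
    by_contra hc
    exact Nat.find_min hex hi ⟨hi.trans (Nat.find_spec hex).1, hc⟩
  obtain ⟨h1, h2, h3⟩ := h.2 k hlt hk
  refine ⟨?_, congrArg B.src (h3 n hkn)⟩
  -- Subtraction of one with a borrow: the digits beyond `k` are unchanged, digit `k` drops by one,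
  -- and the zeros below it become the largest digits, with value p_k - 1.
  rw [suffix_zero_eq hq (Nat.succ_le_of_lt hkn) x, suffix_zero_eq hq (Nat.succ_le_of_lt hkn) y,
    suffix_congr hq (Nat.succ_le_of_lt hkn) (x := y) (y := x) fun i hi _ => h3 i hi,
    suffix_succ hq k.zero_le, suffix_succ hq k.zero_le, (suffix_zero_eq_zero_iff hq).2 hlt,
    ← numAbove_covBy h1]
  have := suffix_of_isMin hq h2
  change B.suffix 0 k y + 1 = qProd q 0 k at this
  rw [mul_add_one]
  omega

theorem IsVershikImage.suffix_of_eq_zero {q : ℕ → ℕ} (hq : B.IsToeplitz q) {n : ℕ}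
    {x y : B.PathSpace} (h : B.IsVershikImage x y) (hs : B.suffix 0 n x = 0) :
    B.suffix 0 n y + 1 = pSeq q n := by
  classical
  rw [suffix_zero_eq_zero_iff hq] at hs
  refine suffix_of_isMin hq fun i hi => ?_
  by_cases hx : ∀ n, IsMax (x n)
  · exact h.1 hx i
  · have hex := not_forall.1 hx
    have hle : n ≤ Nat.find hex := by
      by_contra! hc
      exact Nat.find_spec hex (hs _ hc)
    exact (h.2 _ (fun j hj => not_not.1 (Nat.find_min hex hj)) (Nat.find_spec hex)).2.1 i (by omega)

theorem isVershikImage_vershik (hB : B.IsProperlyOrdered) (x : B.PathSpace) :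
    B.IsVershikImage x (B.vershik hB x) :=
  (existsUnique_vershikImage hB x).choose_spec.1

end OrderedBratteliDiagram

/-! ### Towers -/

/-- `τ` and `s` describe a partition of `X` into towers of the same height `p`: the map `T` goes
down in each tower, `τ x` is the tower of `x` and `s x` its height above the bottom level. -/
structure IsTower {X V : Type*} (T : X → X) (τ : X → V) (s : X → ℕ) (p : ℕ) : Prop where
  lt : ∀ x, s x < p
  of_pos : ∀ x, 0 < s x → s (T x) + 1 = s x ∧ τ (T x) = τ x
  of_eq_zero : ∀ x, s x = 0 → s (T x) + 1 = p

namespace IsTower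

variable {X V : Type*} {T : X → X} {τ : X → V} {s : X → ℕ} {p : ℕ}

/-- Points at height 0 are sent to height p - 1, which `hk` excludes, so the preimage of a level
below the top is exactly the next level of the same tower. -/
theorem apply_iff (h : IsTower T τ s p) {t : V} {k : ℕ} (hk : k + 1 < p) (x : X) :
    (τ (T x) = t ∧ s (T x) = k) ↔ τ x = t ∧ s x = k + 1 := by
  rcases Nat.eq_zero_or_pos (s x) with h0 | h0
  · have := h.of_eq_zero x h0
    constructor <;> rintro ⟨-, h'⟩ <;> omega
  · obtain ⟨h1, h2⟩ := h.of_pos x h0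
    rw [h2, ← h1]
    simp

theorem iterate_mod (h : IsTower T τ s p) (x : X) (k : ℕ) : s (T^[k] x) + k ≡ s x [MOD p] := by
  induction k with
  | zero => rfl
  | succ k ih =>
    rw [Function.iterate_succ_apply']
    refine Nat.ModEq.trans ?_ ih
    rcases Nat.eq_zero_or_pos (s (T^[k] x)) with h0 | h0
    · have := h.of_eq_zero _ h0
      rw [h0, show s (T (T^[k] x)) + (k + 1) = p + k by omega]
      simp [Nat.ModEq]
    · have := (h.of_pos _ h0).1
      rw [show s (T (T^[k] x)) + (k + 1) = s (T^[k] x) + k by omega]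

theorem iterate_height (h : IsTower T τ s p) (x : X) : s (T^[p] x) = s x := by
  have := h.iterate_mod x p
  rw [Nat.ModEq, Nat.add_mod_right] at this
  rwa [Nat.mod_eq_of_lt (h.lt _), Nat.mod_eq_of_lt (h.lt _)] at this

end IsTower

namespace OrderedBratteliDiagram

variable {B : OrderedBratteliDiagram}

/-! ### Topology of the path space -/

theorem hasBasis_nhds_pathSpace (x : B.PathSpace) :
    (𝓝 x).HasBasis (fun _ : ℕ => True) fun n => {y : B.PathSpace | ∀ i < n, y i = x i} := by
  let _ : ∀ n, TopologicalSpace (B.E n) := fun _ => ⊥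
  have : ∀ n, DiscreteTopology (B.E n) := fun _ => ⟨rfl⟩
  have hnhds : 𝓝 x = comap PathSpace.edge (𝓝 x.edge) := nhds_induced _ _
  refine ⟨fun U => ?_⟩
  rw [hnhds, mem_comap]
  simp only [nhds_pi, nhds_discrete, true_and]
  constructor
  · rintro ⟨W, hW, hWU⟩
    obtain ⟨J, hJ, t, ht, hsub⟩ := Filter.mem_pi.1 hW
    obtain ⟨n, hn⟩ := hJ.bddAbove
    refine ⟨n + 1, fun y hy => hWU (hsub fun i hi => ?_)⟩
    rw [hy i (Nat.lt_succ_of_le (hn hi))]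
    exact ht i
  · rintro ⟨n, hn⟩
    refine ⟨{g | ∀ i < n, g i = x i}, ?_, hn⟩
    refine Filter.mem_pi.2 ⟨Set.Iio n, Set.finite_Iio n, fun i => {x i}, fun i => rfl, ?_⟩
    exact fun g hg i hi => hg i hi

theorem isLocallyConstant_of_edges {α : Type*} (f : B.PathSpace → α) (n : ℕ)
    (h : ∀ x y : B.PathSpace, (∀ i < n, y i = x i) → f y = f x) : IsLocallyConstant f :=
  (IsLocallyConstant.iff_eventually_eq f).2 fun x =>
    (hasBasis_nhds_pathSpace x).mem_iff.2 ⟨n, trivial, fun y hy => h x y hy⟩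

theorem isLocallyConstant_tau (n : ℕ) : IsLocallyConstant (B.tau n) :=
  isLocallyConstant_of_edges _ (n + 1) fun _ _ h => congrArg B.src (h n n.lt_succ_self)

theorem isLocallyConstant_suffix {q : ℕ → ℕ} (hq : B.IsToeplitz q) {m n : ℕ} (hmn : m ≤ n) :
    IsLocallyConstant (B.suffix m n) :=
  isLocallyConstant_of_edges _ n fun _ _ h => suffix_congr hq hmn fun i _ hi => h i hi

/-- Two maximal paths of positive length agree up to their last edge if all maximal edges of the
last level have the same source. -/
theorem eq_of_isMax_lt {q : ℕ → ℕ} (hq : B.IsToeplitz q) {n : ℕ}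
    (h4 : ∀ e e' : B.E n, IsMax e → IsMax e' → B.src e = B.src e') {x y : B.PathSpace}
    (hx : ∀ i ≤ n, IsMax (x i)) (hy : ∀ i ≤ n, IsMax (y i)) : ∀ i < n, x i = y i := by
  refine fun i => (eq_of_suffix_eq hq n.zero_le (h4 _ _ (hx n le_rfl) (hy n le_rfl)) ?_).2 i
    i.zero_le
  rw [(suffix_zero_eq_zero_iff hq).2 fun i hi => hx i hi.le,
    (suffix_zero_eq_zero_iff hq).2 fun i hi => hy i hi.le]

theorem pSeq_pos {q : ℕ → ℕ} (hq : B.IsToeplitz q) (x : B.PathSpace) (n : ℕ) : 0 < pSeq q n :=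
  (Nat.zero_le _).trans_lt (suffix_lt hq n.zero_le x)

theorem pSeq_dvd (q : ℕ → ℕ) {m n : ℕ} (h : m ≤ n) : pSeq q m ∣ pSeq q n :=
  ⟨_, (pSeq_mul_qProd q h).symm⟩

/-- The heights of the towers tend to infinity. -/
theorem tendsto_pSeq {q : ℕ → ℕ} (hq : B.IsToeplitz q) (x : B.PathSpace)
    (h2 : ∀ n, 1 ≤ n → ∀ (t₁ : B.V n) (t₂ : B.V (n + 1)), 0 < B.incidence n t₁ t₂)
    (hiso : ∀ x : B.PathSpace, ¬ IsOpen ({x} : Set B.PathSpace)) :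
    Tendsto (pSeq q) atTop atTop := by
  have hmono : Monotone (pSeq q) := fun m n h => Nat.le_of_dvd (pSeq_pos hq x n) (pSeq_dvd q h)
  by_contra hcon
  have hbdd : BddAbove (Set.range (pSeq q)) := by
    by_contra h
    exact hcon (tendsto_atTop_atTop_of_monotone' hmono h)
  obtain ⟨C, hC⟩ := hbdd
  obtain ⟨N, hN⟩ : ∃ N, ∀ n ≥ N, pSeq q n = pSeq q N := by
    obtain ⟨M, ⟨N, rfl⟩, hM⟩ := Set.Finite.exists_maximal (s := Set.range (pSeq q))
      ((Set.finite_Iic C).subset fun _ h => hC h) ⟨_, 0, rfl⟩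
    exact ⟨N, fun n hn => le_antisymm (hM ⟨n, rfl⟩ (hmono hn)) (hmono hn)⟩
  -- With bounded heights all later q are 1. Each vertex then receives one edge, and positivity of
  -- the incidence leaves one vertex per level, so `N` edges determine a path and `x` is isolated.
  have hq1 : ∀ n ≥ N, q (n + 1) = 1 := by
    intro n hn
    have h := hN (n + 1) (by omega)
    rw [pSeq_succ, hN n hn] at h
    exact Nat.eq_of_mul_eq_mul_left (pSeq_pos hq x N) (by omega)
  have hedge : ∀ n ≥ N, ∀ e e' : B.E n, B.tgt e = B.tgt e' → e = e' := by
    intro n hn e e' h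
    have hsub := (Nat.card_eq_one_iff_unique.1 ((hq n (B.tgt e)).trans (hq1 n hn))).1
    exact congrArg Subtype.val (hsub.elim ⟨e, rfl⟩ ⟨e', h.symm⟩)
  have hV : ∀ n ≥ N + 1, Subsingleton (B.V n) := by
    refine fun n hn => ⟨fun t t' => ?_⟩
    obtain ⟨e, he⟩ := (Nat.card_pos_iff.1 (h2 n (by omega) t (B.tgt (x n)))).1
    obtain ⟨e', he'⟩ := (Nat.card_pos_iff.1 (h2 n (by omega) t' (B.tgt (x n)))).1
    rw [← he.1, ← he'.1, hedge n (by omega) e e' (he.2.trans he'.2.symm)]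
  refine hiso x (isOpen_iff_mem_nhds.2 fun y hy => ?_)
  obtain rfl : y = x := hy
  refine (hasBasis_nhds_pathSpace y).mem_iff.2 ⟨N, trivial, fun z hz => ?_⟩
  refine PathSpace.ext (funext fun i => ?_)
  by_cases hi : i < N
  · exact hz i hi
  · exact hedge i (by omega) _ _ ((hV (i + 1) (by omega)).elim _ _)

/-! ### Towers of a representation -/

variable {X : Type*} [TopologicalSpace X] {T : X ≃ₜ X}

theorem Representation.isTower (R : B.Representation T) {q : ℕ → ℕ} (hq : B.IsToeplitz q) (n : ℕ) :
    IsTower T (fun x => B.tau n (R.conj x)) (fun x => B.suffix 0 n (R.conj x)) (pSeq q n) where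
  lt x := suffix_lt hq n.zero_le _
  of_pos x h := by
    simp only [R.conj_apply]
    exact (isVershikImage_vershik R.properlyOrdered _).suffix_of_pos hq h
  of_eq_zero x h := by
    simp only [R.conj_apply]
    exact (isVershikImage_vershik R.properlyOrdered _).suffix_of_eq_zero hq h

theorem Representation.isOpen_singleton_iff (R : B.Representation T) (x : B.PathSpace) :
    IsOpen ({x} : Set B.PathSpace) ↔ IsOpen ({R.conj.symm x} : Set X) := by
  rw [← R.conj.isOpen_image, Set.image_singleton, Homeomorph.apply_symm_apply]

end OrderedBratteliDiagram

/-! ### Continuous eigenvalues -/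

/-- Zeros of an eigenfunction propagate along the full orbit; under minimality a continuous
eigenfunction with a zero therefore vanishes identically. -/
theorem Homeomorph.apply_zpow_eq_zero {X : Type*} [TopologicalSpace X] {T : X ≃ₜ X} {lam : ℂ}
    (hlam : lam ≠ 0) {f : X → ℂ} (hf : ∀ x, f (T x) = lam * f x) {x : X} (hx : f x = 0) (k : ℤ) :
    f ((T ^ k) x) = 0 := by
  induction k with
  | zero => simpa using hx
  | succ k ih =>
    rw [add_comm, zpow_add, zpow_one]
    exact (hf _).trans (mul_eq_zero_of_right _ ih)
  | pred k ih =>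
    have h := hf ((T ^ (-(k : ℤ) - 1)) x)
    have h' : T ((T ^ (-(k : ℤ) - 1)) x) = (T ^ (-(k : ℤ))) x := by
      conv_rhs => rw [show -(k : ℤ) = 1 + (-(k : ℤ) - 1) by ring, zpow_add, zpow_one]
      rfl
    rw [h', ih] at h
    exact (mul_eq_zero.1 h.symm).resolve_left hlam

theorem iterate_eigenfunction {X : Type*} {T : X → X} {lam : ℂ} {f : X → ℂ}
    (hf : ∀ x, f (T x) = lam * f x) (x : X) (k : ℕ) : f (T^[k] x) = lam ^ k * f x := by
  induction k with
  | zero => simp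
  | succ k ih => rw [Function.iterate_succ_apply', hf, ih, pow_succ]; ring

/-- Distinct roots of unity of a given order are separated. -/
theorem exists_le_norm_sub_one (b : ℕ) (hb : 0 < b) :
    ∃ η : ℝ, 0 < η ∧ ∀ z : ℂ, z ^ b = 1 → z ≠ 1 → η ≤ ‖z - 1‖ := by
  have hfin : ({z : ℂ | z ^ b = 1} \ {1}).Finite := by
    refine Set.Finite.subset (Polynomial.nthRootsFinset b (1 : ℂ)).finite_toSet fun z hz => ?_
    simpa [Polynomial.mem_nthRootsFinset hb] using hz.1
  rcases ({z : ℂ | z ^ b = 1} \ {1}).eq_empty_or_nonempty with he | hne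
  · refine ⟨1, one_pos, fun z hz hz1 => ?_⟩
    have : z ∈ ({z : ℂ | z ^ b = 1} \ {1}) := ⟨hz, hz1⟩
    simp [he] at this
  · obtain ⟨w, hw, hmin⟩ := hfin.exists_minimalFor (fun z => ‖z - 1‖) _ hne
    refine ⟨‖w - 1‖, norm_pos_iff.2 (sub_ne_zero.2 hw.2), fun z hz hz1 => ?_⟩
    exact (le_total ‖w - 1‖ ‖z - 1‖).elim id fun h => hmin ⟨hz, hz1⟩ h

namespace OrderedBratteliDiagram

theorem Representation.isContinuousEigenvalue_iff {B : OrderedBratteliDiagram} {X : Type*}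
    [TopologicalSpace X] {T : X ≃ₜ X} (R : B.Representation T) [Nonempty X]
    (hT : IsMinimalSystem T)
    (h4 : ∀ n, 1 ≤ n → ∀ e e' : B.E n, IsMax e → IsMax e' → B.src e = B.src e')
    {q : ℕ → ℕ} (hq : B.IsToeplitz q) {lam : ℂ} {b : ℕ} (hb : 0 < b)
    (hlam : IsPrimitiveRoot lam b) :
    IsContinuousEigenvalue T lam ↔ ∃ n, b ∣ pSeq q n := by
  have hlam0 : lam ≠ 0 := hlam.ne_zero hb.ne'
  constructor
  · rintro ⟨f, hfc, hf0, hf⟩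
    obtain ⟨xmax, hxmax, -⟩ := R.properlyOrdered.1
    obtain ⟨z, rfl⟩ := R.conj.surjective xmax
    have hfz : f z ≠ 0 := by
      intro h0
      refine hf0 (hfc.ext_on (hT z) continuous_const ?_)
      rintro _ ⟨k, rfl⟩
      exact Homeomorph.apply_zpow_eq_zero hlam0 hf h0 k
    obtain ⟨η, hη, hsep⟩ := exists_le_norm_sub_one b hb
    have hnhds : {w | dist (f (R.conj.symm w)) (f z) < ‖f z‖ * η} ∈ 𝓝 (R.conj z) := by
      have hc : ContinuousAt (fun w => f (R.conj.symm w)) (R.conj z) :=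
        (hfc.comp R.conj.symm.continuous).continuousAt
      have h := hc.preimage_mem_nhds (Metric.ball_mem_nhds _ (mul_pos (norm_pos_iff.2 hfz) hη))
      rw [Homeomorph.symm_apply_apply] at h
      exact h
    obtain ⟨n, -, hn⟩ := (hasBasis_nhds_pathSpace _).mem_iff.1 hnhds
    -- The shift by two makes (H4) available at index `n + 1 ≥ 1` and still leaves agreement of the
    -- first `n` edges.
    refine ⟨n + 2, (hlam.pow_eq_one_iff_dvd _).1 ?_⟩
    by_contra hne
    have hlev := (R.isTower hq (n + 2)).iterate_height z
    beta_reduce at hlev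
    -- The return after p_{n+2} steps is again at height 0, so its first `n + 2` edges are maximal.
    rw [(suffix_zero_eq_zero_iff hq (x := R.conj z)).2 fun i _ => hxmax i,
      suffix_zero_eq_zero_iff hq] at hlev
    have hcyl := eq_of_isMax_lt hq (h4 (n + 1) (by omega)) (fun i hi => hlev i (by omega))
      (fun i (_ : i ≤ n + 1) => hxmax i)
    have hd : dist (f (R.conj.symm (R.conj (T^[pSeq q (n + 2)] z)))) (f z) < ‖f z‖ * η :=
      hn fun i hi => hcyl i (by omega)
    rw [Homeomorph.symm_apply_apply, iterate_eigenfunction hf, dist_eq_norm, ← sub_one_mul,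
      norm_mul, mul_comm, mul_lt_mul_iff_right₀ (norm_pos_iff.2 hfz)] at hd
    refine (hsep _ ?_ hne).not_gt hd
    rw [← pow_mul, mul_comm, pow_mul, hlam.pow_eq_one, one_pow]
  · rintro ⟨n, hn⟩
    have htow := R.isTower hq n
    refine ⟨fun x => lam⁻¹ ^ B.suffix 0 n (R.conj x), ?_, ?_, fun x => ?_⟩
    · exact (((isLocallyConstant_suffix hq n.zero_le).comp (fun k => lam⁻¹ ^ k)).continuous).comp
        R.conj.continuous
    · obtain ⟨x⟩ := ‹Nonempty X›
      exact fun h => pow_ne_zero _ (inv_ne_zero hlam0) (congrFun h x)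
    · beta_reduce
      rcases Nat.eq_zero_or_pos (B.suffix 0 n (R.conj x)) with h0 | h0
      · have h1 : B.suffix 0 n (R.conj (T x)) + 1 = _ := htow.of_eq_zero x h0
        have h2 : lam⁻¹ ^ (B.suffix 0 n (R.conj (T x)) + 1) = 1 := by
          rw [h1, inv_pow, (hlam.pow_eq_one_iff_dvd _).2 hn, inv_one]
        rw [h0, pow_zero, mul_one]
        rw [pow_succ] at h2
        exact (eq_mul_inv_iff_mul_eq₀ (inv_ne_zero hlam0)).2 h2 |>.trans (by simp)
      · have h1 : B.suffix 0 n (R.conj (T x)) + 1 = B.suffix 0 n (R.conj x) := (htow.of_pos x h0).1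
        rw [← h1, pow_succ]
        field_simp
end OrderedBratteliDiagram

/-! ### Integrals over towers -/

/-- The mean `c` is, up to a factor 2, as good an L¹ approximation as any constant `a`, since |a -
c| is at most the average of |F - a|. The mean is given in product form so that null measures need
no separate treatment. -/
theorem integral_norm_sub_const_le {X : Type*} [MeasurableSpace X] {ν : Measure X}
    [IsFiniteMeasure ν] {F : X → ℂ} (hF : Integrable F ν) {c : ℂ}
    (hc : (ν.real Set.univ : ℂ) * c = ∫ x, F x ∂ν) (a : ℂ) :
    ∫ x, ‖F x - c‖ ∂ν ≤ 2 * ∫ x, ‖F x - a‖ ∂ν := by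
  have hint : ∀ u : ℂ, Integrable (fun x => F x - u) ν := fun u => hF.sub (integrable_const u)
  have h1 : ν.real Set.univ * ‖a - c‖ ≤ ∫ x, ‖F x - a‖ ∂ν := by
    calc ν.real Set.univ * ‖a - c‖ = ‖∫ x, (F x - a) ∂ν‖ := by
          rw [integral_sub hF (integrable_const a), integral_const, ← hc, Complex.real_smul,
            ← mul_sub, norm_mul, norm_sub_rev, Complex.norm_real, Real.norm_of_nonneg (by positivity)]
      _ ≤ _ := norm_integral_le_integral_norm _
  calc ∫ x, ‖F x - c‖ ∂ν ≤ ∫ x, (‖F x - a‖ + ‖a - c‖) ∂ν :=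
        integral_mono (hint c).norm ((hint a).norm.add (integrable_const _)) fun x => by
          simpa using norm_add_le (F x - a) (a - c)
    _ = ∫ x, ‖F x - a‖ ∂ν + ν.real Set.univ * ‖a - c‖ := by
          rw [integral_add (hint a).norm (integrable_const _), integral_const, smul_eq_mul]
    _ ≤ _ := by linarith

/-- The integral over a set is the sum of the integrals over the fibres of a function with finitely
many values. -/
theorem setIntegral_eq_sum_fiber {X E ι : Type*} [MeasurableSpace X] {μ : Measure X}
    [NormedAddCommGroup E] [NormedSpace ℝ E] {F : X → E} (hF : Integrable F μ) {A : Set X}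
    (K : Finset ι) (φ : X → ι) (hφ : ∀ x ∈ A, φ x ∈ K)
    (hm : ∀ i ∈ K, MeasurableSet {x | x ∈ A ∧ φ x = i}) :
    ∫ x in A, F x ∂μ = ∑ i ∈ K, ∫ x in {x | x ∈ A ∧ φ x = i}, F x ∂μ := by
  rw [← integral_biUnion_finset K hm ?_ fun i _ => hF.integrableOn]
  · congr 2
    ext x
    simp only [Set.mem_iUnion, Set.mem_ofPred_eq]
    exact ⟨fun h => ⟨φ x, hφ x h, h, rfl⟩, fun ⟨_, _, h, _⟩ => h⟩
  · intro i _ j _ hij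
    exact Set.disjoint_left.2 fun x hx hx' => hij (hx.2.symm.trans hx'.2)

namespace IsTower

variable {X V : Type*} [MeasurableSpace X] {T : X → X} {τ : X → V} {s : X → ℕ} {p : ℕ}
  {μ : Measure X} {E : Type*} [NormedAddCommGroup E] [NormedSpace ℝ E]

/-- Consecutive levels are preimages of each other under a measure-preserving map, and invariance of
`F` is needed only off the bottom level. -/
theorem setIntegral_level (h : IsTower T τ s p) (hT : MeasurePreserving T μ μ)
    (hTe : MeasurableEmbedding T) (hm : ∀ t k, MeasurableSet {x | τ x = t ∧ s x = k})
    {F : X → E} (hinv : ∀ᵐ x ∂μ, 0 < s x → F (T x) = F x)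
    (t : V) {k : ℕ} (hk : k < p) :
    ∫ x in {x | τ x = t ∧ s x = k}, F x ∂μ = ∫ x in {x | τ x = t ∧ s x = 0}, F x ∂μ := by
  induction k with
  | zero => rfl
  | succ k ih =>
    rw [← ih (by omega), ← hT.setIntegral_preimage_emb hTe F {x | τ x = t ∧ s x = k}]
    have hset : T ⁻¹' {x | τ x = t ∧ s x = k} = {x | τ x = t ∧ s x = k + 1} := by
      ext x
      exact h.apply_iff hk x
    rw [hset]
    refine setIntegral_congr_ae (hm _ _) ?_
    filter_upwards [hinv] with x hx hx'
    exact (hx (by rw [hx'.2]; omega)).symm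

theorem setIntegral_tower (h : IsTower T τ s p) (hT : MeasurePreserving T μ μ)
    (hTe : MeasurableEmbedding T) (hm : ∀ t k, MeasurableSet {x | τ x = t ∧ s x = k})
    {F : X → E} (hF : Integrable F μ) (hinv : ∀ᵐ x ∂μ, 0 < s x → F (T x) = F x)
    (t : V) {k : ℕ} (hk : k < p) :
    ∫ x in {x | τ x = t}, F x ∂μ = (p : ℝ) • ∫ x in {x | τ x = t ∧ s x = k}, F x ∂μ := by
  rw [setIntegral_eq_sum_fiber hF (A := {x | τ x = t}) (Finset.range p) s
    (fun x _ => Finset.mem_range.2 (h.lt x)) fun i _ => hm t i]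
  simp only [Set.mem_ofPred_eq]
  rw [h.setIntegral_level hT hTe hm hinv t hk]
  rw [Finset.sum_congr rfl fun i hi =>
    h.setIntegral_level hT hTe hm hinv t (Finset.mem_range.1 hi)]
  simp [Nat.cast_smul_eq_nsmul]

theorem measureReal_tower [IsProbabilityMeasure μ] (h : IsTower T τ s p)
    (hT : MeasurePreserving T μ μ)
    (hTe : MeasurableEmbedding T) (hm : ∀ t k, MeasurableSet {x | τ x = t ∧ s x = k})
    (t : V) {k : ℕ} (hk : k < p) :
    μ.real {x | τ x = t} = p * μ.real {x | τ x = t ∧ s x = k} := by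
  have := h.setIntegral_tower hT hTe hm (F := fun _ => (1 : ℝ)) (integrable_const 1)
    (ae_of_all _ fun _ _ => rfl) t hk
  simpa using this

theorem measureReal_tower_mem [IsProbabilityMeasure μ] (h : IsTower T τ s p)
    (hT : MeasurePreserving T μ μ)
    (hTe : MeasurableEmbedding T) (hm : ∀ t k, MeasurableSet {x | τ x = t ∧ s x = k})
    (t : V) (K : Finset ℕ) (hK : ∀ k ∈ K, k < p) :
    p * μ.real {x | τ x = t ∧ s x ∈ K} = K.card * μ.real {x | τ x = t} := by
  have hset : {x | τ x = t ∧ s x ∈ K} = ⋃ k ∈ K, {x | τ x = t ∧ s x = k} := by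
    ext x
    simp
  rw [hset, measureReal_biUnion_finset ?_ fun k _ => hm t k, Finset.mul_sum,
    Finset.sum_congr rfl fun k hk => (h.measureReal_tower hT hTe hm t (hK k hk)).symm]
  · simp
  · intro i _ j _ hij
    exact Set.disjoint_left.2 fun x hx hx' => hij (hx.2.symm.trans hx'.2)

/-- The average over each tower of an integrable function that is invariant along the towers
approximates it if it is nearly constant on the levels of the towers. -/
theorem integral_norm_sub_average_le [IsProbabilityMeasure μ] [Fintype V]
    (h : IsTower T τ s p)
    (hT : MeasurePreserving T μ μ)
    (hTe : MeasurableEmbedding T) (hm : ∀ t k, MeasurableSet {x | τ x = t ∧ s x = k})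
    {lam : ℂ} (hlam : ‖lam‖ = 1) {f g : X → ℂ} (hf : Integrable f μ) (hg : Integrable g μ)
    (hF : Integrable (fun x => lam ^ s x * f x) μ)
    (hinv : ∀ᵐ x ∂μ, 0 < s x → lam ^ s (T x) * f (T x) = lam ^ s x * f x) {ε : ℝ}
    (hfg : ∫ x, ‖f x - g x‖ ∂μ ≤ ε)
    (hgs : ∀ x y, τ x = τ y → s x = s y → ‖g x - g y‖ ≤ ε)
    {c : V → ℂ} (hc : ∀ t, (μ.real {x | τ x = t} : ℂ) * c t
      = ∫ x in {x | τ x = t}, lam ^ s x * f x ∂μ)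
    (hcint : Integrable (fun x => lam ^ s x * f x - c (τ x)) μ) :
    ∫ x, ‖lam ^ s x * f x - c (τ x)‖ ∂μ ≤ 4 * ε := by
  classical
  have hfgi : Integrable (fun x => ‖f x - g x‖ + ε) μ := (hf.sub hg).norm.add (integrable_const _)
  have key : ∀ t, ∀ k ∈ Finset.range p,
      ∫ x in {x | τ x = t ∧ s x = k}, ‖lam ^ s x * f x - c (τ x)‖ ∂μ ≤
        2 * ∫ x in {x | τ x = t ∧ s x = k}, (‖f x - g x‖ + ε) ∂μ := by
    intro t k hk
    rw [Finset.mem_range] at hk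
    rcases Set.eq_empty_or_nonempty {x | τ x = t ∧ s x = k} with he | ⟨x₀, hx₀⟩
    · simp [he]
    have hp : (p : ℂ) ≠ 0 := Nat.cast_ne_zero.2 (by omega)
    have h1 : ∫ x in {x | τ x = t ∧ s x = k}, ‖lam ^ s x * f x - c (τ x)‖ ∂μ =
        ∫ x in {x | τ x = t ∧ s x = k}, ‖lam ^ s x * f x - c t‖ ∂μ :=
      setIntegral_congr_fun (hm t k) fun x hx => by
        have : τ x = t := hx.1
        simp only [this]
    rw [h1]
    -- By invariance the tower average `c t` is also the mean over this level, so it may be compared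
    -- with the constant suggested by `g` at a point of the level.
    refine (integral_norm_sub_const_le hF.integrableOn (c := c t) ?_ (lam ^ k * g x₀)).trans ?_
    · rw [measureReal_restrict_apply_univ]
      refine mul_left_cancel₀ hp ?_
      have h2 := h.setIntegral_tower hT hTe hm hF hinv t hk
      rw [← hc, h.measureReal_tower hT hTe hm t hk, Complex.real_smul] at h2
      push_cast at h2
      rw [← mul_assoc]
      exact h2
    · refine mul_le_mul_of_nonneg_left (setIntegral_mono_on ?_ hfgi.integrableOn (hm t k) ?_)
        zero_le_two
      · exact (hF.sub (integrable_const _)).norm.integrableOn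
      · intro x hx
        rw [show s x = k from hx.2, ← mul_sub, norm_mul, norm_pow, hlam, one_pow, one_mul]
        calc ‖f x - g x₀‖ ≤ ‖f x - g x‖ + ‖g x - g x₀‖ := norm_sub_le_norm_sub_add_norm_sub _ _ _
          _ ≤ _ := by
            gcongr
            exact hgs x x₀ (hx.1.trans hx₀.1.symm) (hx.2.trans hx₀.2.symm)
  have hsplit : ∀ G : X → ℝ, Integrable G μ → ∫ x, G x ∂μ =
      ∑ i ∈ (Finset.univ : Finset V) ×ˢ Finset.range p,
        ∫ x in {x | τ x = i.1 ∧ s x = i.2}, G x ∂μ := by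
    intro G hG
    have hset : ∀ i : V × ℕ, {x | τ x = i.1 ∧ s x = i.2} =
        {x | x ∈ Set.univ ∧ (τ x, s x) = i} := by
      intro i
      ext x
      simp [Prod.ext_iff]
    rw [← setIntegral_univ, setIntegral_eq_sum_fiber hG
      ((Finset.univ : Finset V) ×ˢ Finset.range p) (fun x => (τ x, s x))]
    · simp_rw [hset]
    · simp [h.lt]
    · exact fun i _ => by rw [← hset]; exact hm _ _
  rw [hsplit _ hcint.norm]
  calc _ ≤ ∑ i ∈ (Finset.univ : Finset V) ×ˢ Finset.range p,
        2 * ∫ x in {x | τ x = i.1 ∧ s x = i.2}, (‖f x - g x‖ + ε) ∂μ :=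
      Finset.sum_le_sum fun i hi => key i.1 i.2 (Finset.mem_product.1 hi).2
    _ = 2 * ∫ x, (‖f x - g x‖ + ε) ∂μ := by rw [← Finset.mul_sum, ← hsplit _ hfgi]
    _ ≤ _ := by
      have hadd : ∫ x, (‖f x - g x‖ + ε) ∂μ = ∫ x, ‖f x - g x‖ ∂μ + ∫ _, ε ∂μ :=
        integral_add (hf.sub hg).norm (integrable_const _)
      rw [hadd]
      simp only [integral_const, probReal_univ, one_smul]
      linarith

end IsTower

/-! ### Rotation invariance of an eigenfunction -/

theorem ae_iterate_eigenfunction {X : Type*} [MeasurableSpace X] {μ : Measure X} {T : X → X}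
    (hT : MeasurePreserving T μ μ) {lam : ℂ} {f : X → ℂ}
    (hf : ∀ᵐ x ∂μ, f (T x) = lam * f x) (k : ℕ) : ∀ᵐ x ∂μ, f (T^[k] x) = lam ^ k * f x := by
  induction k with
  | zero => simp
  | succ k ih =>
    filter_upwards [ih, (hT.iterate k).quasiMeasurePreserving.ae hf] with x h1 h2
    rw [Function.iterate_succ_apply', h2, h1, pow_succ]
    ring

/-- If the law of a function of modulus one is invariant under rotation by a primitive `r`-th root
of unity, and the function is close in `L¹` to functions with at most `d` values, then `r ≤ d`. -/
theorem le_of_rotation_invariant {X V : Type*} [MeasurableSpace X] {μ : Measure X}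
    [IsProbabilityMeasure μ] [Fintype V] {S : X → X} (hS : MeasurePreserving S μ μ) {r : ℕ}
    {F : X → ℂ} (hFm : Measurable F) (hF1 : ∀ᵐ x ∂μ, ‖F x‖ = 1) {z : ℂ}
    (hz : IsPrimitiveRoot z r) (hr : 0 < r) (hFS : ∀ᵐ x ∂μ, F (S x) = z * F x) {η : ℝ} (hη : 0 < η)
    (hsep : ∀ k, z ^ k ≠ 1 → η ≤ ‖z ^ k - 1‖)
    {τ : X → V} {c : V → ℂ} (hint : Integrable (fun x => F x - c (τ x)) μ)
    (hsmall : ∫ x, ‖F x - c (τ x)‖ ∂μ < η / 2 / r) : r ≤ Fintype.card V := by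
  classical
  have hz1 : ‖z‖ = 1 := hz.norm'_eq_one hr.ne'
  -- The preimages of the ball under the `r` rotations have equal measure, and they are disjoint
  -- because the rotates of a unit number are at least `η` apart.
  have hball : ∀ t, r * μ.real {x | ‖F x - c t‖ < η / 2} ≤ 1 := by
    intro t
    have hmeas : ∀ j : ℕ, MeasurableSet {x | ‖z ^ j * F x - c t‖ < η / 2 ∧ ‖F x‖ = 1} := fun j =>
      (measurableSet_lt (((hFm.const_mul _).sub_const _).norm) measurable_const).inter
        (measurableSet_eq_fun hFm.norm measurable_const)
    have hm0 : MeasurableSet {x | ‖F x - c t‖ < η / 2} :=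
      measurableSet_lt ((hFm.sub_const _).norm) measurable_const
    have hj : ∀ j : ℕ, μ.real {x | ‖z ^ j * F x - c t‖ < η / 2 ∧ ‖F x‖ = 1} =
        μ.real {x | ‖F x - c t‖ < η / 2} := by
      intro j
      rw [← (hS.iterate j).measureReal_preimage hm0.nullMeasurableSet]
      refine measureReal_congr ?_
      filter_upwards [hF1, ae_iterate_eigenfunction hS hFS j] with x h1 h2
      refine propext ?_
      change (_ ∧ _) ↔ ‖F (S^[j] x) - c t‖ < η / 2
      rw [h2]
      exact and_iff_left h1
    have hle : μ.real (⋃ j ∈ Finset.range r, {x | ‖z ^ j * F x - c t‖ < η / 2 ∧ ‖F x‖ = 1}) ≤ 1 :=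
      measureReal_le_one
    rw [measureReal_biUnion_finset ?_ fun j _ => hmeas j, Finset.sum_congr rfl fun j _ => hj j] at hle
    · simpa using hle
    · have hlt : ∀ i j : ℕ, i < j → j < r →
          Disjoint {x | ‖z ^ i * F x - c t‖ < η / 2 ∧ ‖F x‖ = 1}
            {x | ‖z ^ j * F x - c t‖ < η / 2 ∧ ‖F x‖ = 1} := by
        refine fun i j hij hj => Set.disjoint_left.2 fun x hx hx' => ?_
        have h1 : ‖z ^ j * F x - z ^ i * F x‖ < η := by
          calc _ ≤ ‖z ^ j * F x - c t‖ + ‖c t - z ^ i * F x‖ :=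
                norm_sub_le_norm_sub_add_norm_sub _ _ _
            _ < η / 2 + η / 2 := add_lt_add hx'.1 (by rw [norm_sub_rev]; exact hx.1)
            _ = η := add_halves η
        have h2 : z ^ j * F x - z ^ i * F x = z ^ i * ((z ^ (j - i) - 1) * F x) := by
          rw [← mul_assoc, mul_sub, ← pow_add, Nat.add_sub_of_le hij.le]
          ring
        rw [h2, norm_mul, norm_mul, norm_pow, hz1, one_pow, one_mul, hx.2, mul_one] at h1
        exact (hsep (j - i) (hz.pow_ne_one_of_pos_of_lt (by omega) (by omega))).not_gt h1
      intro i hi j hj hij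
      simp only [Finset.coe_range, Set.mem_Iio] at hi hj
      rcases lt_or_gt_of_ne hij with h | h
      · exact hlt i j h hj
      · exact (hlt j i h hi).symm
  have hmarkov : η / 2 * μ.real {x | η / 2 ≤ ‖F x - c (τ x)‖} < η / 2 / r :=
    (mul_meas_ge_le_integral_of_nonneg (ae_of_all _ fun _ => norm_nonneg _) hint.norm _).trans_lt
      hsmall
  have hcover : (1 : ℝ) ≤ μ.real {x | η / 2 ≤ ‖F x - c (τ x)‖} +
      ∑ t : V, μ.real {x | ‖F x - c t‖ < η / 2} := by
    rw [← probReal_univ (μ := μ)]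
    refine (measureReal_mono ?_).trans ((measureReal_union_le _
      (⋃ t ∈ (Finset.univ : Finset V), {x | ‖F x - c t‖ < η / 2})).trans
      (add_le_add_right (measureReal_biUnion_finset_le _ _) _))
    intro x _
    rcases le_or_gt (η / 2) ‖F x - c (τ x)‖ with h | h
    · exact Or.inl h
    · exact Or.inr (by simpa using ⟨_, h⟩)
  have hr' : (0 : ℝ) < r := Nat.cast_pos.2 hr
  have h1 : r * μ.real {x | η / 2 ≤ ‖F x - c (τ x)‖} < 1 := by
    have h2 : η / 2 * (r * μ.real {x | η / 2 ≤ ‖F x - c (τ x)‖}) < η / 2 * 1 := by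
      rw [lt_div_iff₀ hr'] at hmarkov
      linarith
    exact lt_of_mul_lt_mul_left h2 (by positivity)
  -- After multiplication by `r`, the exceptional set contributes less than 1 and each ball at most
  -- 1; integrality then gives the bound.
  have h3 : (r : ℝ) < 1 + Fintype.card V := by
    calc (r : ℝ) = r * 1 := (mul_one _).symm
      _ ≤ r * (μ.real {x | η / 2 ≤ ‖F x - c (τ x)‖} +
          ∑ t : V, μ.real {x | ‖F x - c t‖ < η / 2}) := by gcongr
      _ < 1 + ∑ t : V, (1 : ℝ) := by
        rw [mul_add, Finset.mul_sum]
        exact add_lt_add_of_lt_of_le h1 (Finset.sum_le_sum fun t _ => hball t)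
      _ = _ := by simp
  have h4 : r < 1 + Fintype.card V := by exact_mod_cast h3
  omega

/-- An eigenfunction of an ergodic system may be normalized to have modulus one. -/
theorem IsMeasurableEigenvalue.exists_norm_eq_one {X : Type*} [TopologicalSpace X]
    [MeasurableSpace X] [BorelSpace X] {T : X ≃ₜ X} {μ : Measure X} [IsProbabilityMeasure μ]
    (hμ : Ergodic T μ) {lam : ℂ} (hlam : ‖lam‖ = 1) (h : IsMeasurableEigenvalue T μ lam) :
    ∃ f : X → ℂ, Measurable f ∧ Integrable f μ ∧ (∀ᵐ x ∂μ, ‖f x‖ = 1) ∧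
      ∀ᵐ x ∂μ, f (T x) = lam * f x := by
  obtain ⟨f, hf, hf0, hfT⟩ := h
  obtain ⟨g, hg, hfg⟩ := hf.1
  have hgT : ∀ᵐ x ∂μ, g (T x) = lam * g x := by
    filter_upwards [hfg, hfT, hμ.toMeasurePreserving.quasiMeasurePreserving.ae_eq_comp hfg]
      with x h1 h2 h3
    rw [← h1, ← h2]
    exact h3.symm
  -- The modulus is invariant because |λ| = 1, hence constant by ergodicity.
  obtain ⟨C, hC⟩ := hμ.ae_eq_const_of_ae_eq_comp_ae (g := fun x => ‖g x‖)
    hg.norm.aestronglyMeasurable (by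
      filter_upwards [hgT] with x hx
      rw [Function.comp_apply, hx, norm_mul, hlam, one_mul])
  have hC0 : C ≠ 0 := by
    rintro rfl
    refine hf0 ?_
    filter_upwards [hfg, hC] with x h1 h2
    rw [h1]
    exact norm_eq_zero.1 h2
  have hCpos : 0 < C := by
    obtain ⟨x, hx⟩ := hC.exists
    exact lt_of_le_of_ne ((norm_nonneg (g x)).trans_eq hx) hC0.symm
  have hn : ∀ᵐ x ∂μ, ‖(C : ℂ)⁻¹ * g x‖ = 1 := by
    filter_upwards [hC] with x hx
    rw [norm_mul, hx, norm_inv, Complex.norm_real, Real.norm_of_nonneg hCpos.le]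
    exact inv_mul_cancel₀ hC0
  refine ⟨fun x => (C : ℂ)⁻¹ * g x, hg.measurable.const_mul _, ?_, hn, ?_⟩
  · refine Integrable.of_bound (hg.measurable.const_mul _).aestronglyMeasurable 1 ?_
    exact hn.mono fun x hx => hx.le
  · filter_upwards [hgT] with x hx
    rw [hx]
    ring

/-! ### Suffix sets, uniform distribution and approximation by functions of the tower. -/

namespace OrderedBratteliDiagram

variable {B : OrderedBratteliDiagram}

theorem suffixSet_subset {q : ℕ → ℕ} (hq : B.IsToeplitz q) {m n : ℕ} (hmn : m ≤ n) (t₁ : B.V m)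
    (t₂ : B.V n) : B.suffixSet m n t₁ t₂ ⊆ Finset.range (qProd q m n) := by
  rintro s ⟨x, -, -, rfl⟩
  simpa using suffix_lt hq hmn x

theorem suffixSet_finite {q : ℕ → ℕ} (hq : B.IsToeplitz q) {m n : ℕ} (hmn : m ≤ n) (t₁ : B.V m)
    (t₂ : B.V n) : (B.suffixSet m n t₁ t₂).Finite :=
  (Finset.finite_toSet _).subset (suffixSet_subset hq hmn t₁ t₂)

/-- End-point and suffix determine the starting vertex of the segment. Hence the suffix sets for
different `t₁` are disjoint. -/
theorem suffix_mem_suffixSet_iff {q : ℕ → ℕ} (hq : B.IsToeplitz q) {m n : ℕ} (hmn : m ≤ n)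
    {t₁ : B.V m} {t₂ : B.V n} {x : B.PathSpace} (hx : B.tau n x = t₂) :
    B.suffix m n x ∈ B.suffixSet m n t₁ t₂ ↔ B.tau m x = t₁ := by
  constructor
  · rintro ⟨y, hy1, hy2, hy3⟩
    rw [← hy1]
    exact (eq_of_suffix_eq hq hmn (hx.trans hy2.symm) hy3.symm).1
  · exact fun h => ⟨x, h, hx, rfl⟩

theorem sum_norm_suffixSet_le {q : ℕ → ℕ} (hq : B.IsToeplitz q) {m n : ℕ} (hmn : m ≤ n)
    (t₂ : B.V n) {w : ℕ → ℂ} (hw : ∀ s, ‖w s‖ ≤ 1) :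
    ∑ t₁ : B.V m, ‖∑ᶠ s ∈ B.suffixSet m n t₁ t₂, w s‖ ≤ qProd q m n := by
  classical
  have hfin := fun t₁ => suffixSet_finite hq hmn t₁ t₂
  have hdisj : ∀ t ∈ (Finset.univ : Finset (B.V m)), ∀ t' ∈ (Finset.univ : Finset (B.V m)),
      t ≠ t' → Disjoint (hfin t).toFinset (hfin t').toFinset := by
    refine fun t _ t' _ hne => Finset.disjoint_left.2 fun s hs hs' => hne ?_
    rw [Set.Finite.mem_toFinset] at hs hs'
    obtain ⟨x, h1, h2, rfl⟩ := hs
    exact h1.symm.trans ((suffix_mem_suffixSet_iff hq hmn h2).1 hs')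
  calc ∑ t₁ : B.V m, ‖∑ᶠ s ∈ B.suffixSet m n t₁ t₂, w s‖
      ≤ ∑ t₁ : B.V m, ((hfin t₁).toFinset.card : ℝ) := by
        refine Finset.sum_le_sum fun t₁ _ => ?_
        rw [finsum_mem_eq_finite_toFinset_sum _ (hfin t₁)]
        refine (norm_sum_le _ _).trans ((Finset.sum_le_sum fun s _ => hw s).trans ?_)
        simp
    _ = ((Finset.univ.biUnion fun t₁ => (hfin t₁).toFinset).card : ℝ) := by
        rw [Finset.card_biUnion hdisj]
        push_cast
        rfl
    _ ≤ _ := by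
        refine Nat.cast_le.2 ((Finset.card_le_card (Finset.biUnion_subset.2 fun t₁ _ s hs => ?_)).trans
          (Finset.card_range _).le)
        exact Finset.mem_coe.1 (suffixSet_subset hq hmn t₁ t₂ ((hfin t₁).mem_toFinset.1 hs))

namespace Representation

variable {X : Type*} [TopologicalSpace X] {T : X ≃ₜ X} (R : B.Representation T)

theorem continuous_comp {α β : Type*} [TopologicalSpace β] {φ : B.PathSpace → α}
    (hφ : IsLocallyConstant φ) (w : α → β) : Continuous fun x => w (φ (R.conj x)) :=
  (hφ.comp w).continuous.comp R.conj.continuous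

/-- A continuous function on `X` is nearly constant on the levels of the towers. -/
theorem exists_norm_sub_le [CompactSpace X] {q : ℕ → ℕ} (hq : B.IsToeplitz q) {g : X → ℂ}
    (hg : Continuous g) {ε : ℝ} (hε : 0 < ε) :
    ∃ M, ∀ m ≥ M, ∀ x y, B.tau m (R.conj x) = B.tau m (R.conj y) →
      B.suffix 0 m (R.conj x) = B.suffix 0 m (R.conj y) → ‖g x - g y‖ ≤ ε := by
  have hloc : ∀ x : X, ∃ n : ℕ, ∀ y, (∀ i < n, R.conj y i = R.conj x i) → ‖g y - g x‖ < ε / 2 := by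
    intro x
    have hnhds : (fun w => g (R.conj.symm w)) ⁻¹' Metric.ball (g x) (ε / 2) ∈ 𝓝 (R.conj x) := by
      refine (hg.comp R.conj.symm.continuous).continuousAt.preimage_mem_nhds ?_
      rw [Function.comp_apply, Homeomorph.symm_apply_apply]
      exact Metric.ball_mem_nhds _ (half_pos hε)
    obtain ⟨n, -, hn⟩ := (hasBasis_nhds_pathSpace _).mem_iff.1 hnhds
    refine ⟨n, fun y hy => ?_⟩
    have h := hn hy
    rwa [Set.mem_preimage, Homeomorph.symm_apply_apply, mem_ball_iff_norm] at h
  choose n hn using hloc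
  have hU : ∀ x : X, {y | ∀ i < n x, R.conj y i = R.conj x i} ∈ 𝓝 x := fun x =>
    R.conj.continuous.continuousAt.preimage_mem_nhds
      ((hasBasis_nhds_pathSpace (R.conj x)).mem_of_mem (i := n x) trivial)
  obtain ⟨S, hS⟩ := CompactSpace.elim_nhds_subcover _ hU
  refine ⟨S.sup n, fun m hm x y ht hs => ?_⟩
  have hxy := (eq_of_suffix_eq hq m.zero_le ht hs).2
  have hx : x ∈ ⋃ z ∈ S, {y | ∀ i < n z, R.conj y i = R.conj z i} := hS ▸ Set.mem_univ x
  simp only [Set.mem_iUnion] at hx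
  obtain ⟨z, hzS, hz⟩ := hx
  have hnz : n z ≤ m := (Finset.le_sup hzS).trans hm
  have h1 := hn z x hz
  have h2 := hn z y fun i hi => (hxy i i.zero_le (by omega)).symm.trans (hz i hi)
  calc ‖g x - g y‖ ≤ ‖g x - g z‖ + ‖g z - g y‖ := norm_sub_le_norm_sub_add_norm_sub _ _ _
    _ ≤ ε / 2 + ε / 2 := add_le_add h1.le (by rw [norm_sub_rev]; exact h2.le)
    _ = ε := add_halves ε

variable [MeasurableSpace X] [BorelSpace X] {μ : Measure X}

theorem measurableSet_fiber {α : Type*} {φ : B.PathSpace → α} (hφ : IsLocallyConstant φ) (a : α) :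
    MeasurableSet {x | φ (R.conj x) = a} :=
  ((hφ.isOpen_fiber a).preimage R.conj.continuous).measurableSet

theorem measurableSet_level {q : ℕ → ℕ} (hq : B.IsToeplitz q) {m n : ℕ} (hmn : m ≤ n) (t : B.V n)
    (k : ℕ) : MeasurableSet {x | B.tau n (R.conj x) = t ∧ B.suffix m n (R.conj x) = k} :=
  (R.measurableSet_fiber (isLocallyConstant_tau n) t).inter
    (R.measurableSet_fiber (isLocallyConstant_suffix hq hmn) k)

theorem measurableEmbedding : MeasurableEmbedding T := T.isClosedEmbedding.measurableEmbedding

variable [IsProbabilityMeasure μ]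

theorem measureReal_suffix_eq {q : ℕ → ℕ} (hq : B.IsToeplitz q) (hT : MeasurePreserving T μ μ)
    {m n : ℕ} (hmn : m ≤ n) (t : B.V n) {s : ℕ} (hs : s < qProd q m n) :
    qProd q m n * μ.real {x | B.tau n (R.conj x) = t ∧ B.suffix m n (R.conj x) = s} =
      μ.real {x | B.tau n (R.conj x) = t} := by
  obtain ⟨x₀⟩ := nonempty_of_isProbabilityMeasure μ
  have hpos := pSeq_pos hq (R.conj x₀) m
  have h := (R.isTower hq n).measureReal_tower_mem hT measurableEmbedding
    (R.measurableSet_level hq n.zero_le) t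
    -- Since s_n = s_m + p_m s_{m,n} with s_m < p_m, fixing s_{m,n} = s selects this block of p_m
    -- consecutive levels.
    (Finset.Ico (pSeq q m * s) (pSeq q m * s + pSeq q m)) (fun k hk => by
      rw [Finset.mem_Ico] at hk
      rw [← pSeq_mul_qProd q hmn]
      refine hk.2.trans_le ?_
      rw [← mul_add_one]
      exact Nat.mul_le_mul_left _ hs)
  have hset : {x | B.tau n (R.conj x) = t ∧ B.suffix 0 n (R.conj x) ∈
      Finset.Ico (pSeq q m * s) (pSeq q m * s + pSeq q m)} =
      {x | B.tau n (R.conj x) = t ∧ B.suffix m n (R.conj x) = s} := by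
    ext x
    refine and_congr_right fun _ => ?_
    have hlt : B.suffix 0 m (R.conj x) < pSeq q m := suffix_lt hq m.zero_le _
    rw [suffix_zero_eq hq hmn, Finset.mem_Ico, ← mul_add_one]
    constructor
    · rintro ⟨h1, h2⟩
      have h3 : pSeq q m * B.suffix m n (R.conj x) < pSeq q m * (s + 1) := by omega
      have h4 : pSeq q m * s < pSeq q m * (B.suffix m n (R.conj x) + 1) := by
        rw [mul_add_one]
        omega
      have := Nat.lt_of_mul_lt_mul_left h3
      have := Nat.lt_of_mul_lt_mul_left h4
      omega
    · rintro rfl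
      rw [mul_add_one]
      omega
  rw [hset, Nat.card_Ico, Nat.add_sub_cancel_left, ← pSeq_mul_qProd q hmn] at h
  push_cast at h
  rw [mul_assoc] at h
  exact mul_left_cancel₀ (Nat.cast_ne_zero.2 hpos.ne') h

/-- Given the tower of level `n`, the suffix is uniformly distributed. -/
theorem setIntegral_suffix {q : ℕ → ℕ} (hq : B.IsToeplitz q) (hT : MeasurePreserving T μ μ)
    {m n : ℕ} (hmn : m ≤ n) (t₁ : B.V m) (t₂ : B.V n) {w : ℕ → ℂ} (hw : ∀ s, ‖w s‖ ≤ 1) :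
    (qProd q m n : ℂ) * ∫ x in {x | B.tau m (R.conj x) = t₁ ∧ B.tau n (R.conj x) = t₂},
      w (B.suffix m n (R.conj x)) ∂μ =
      μ.real {x | B.tau n (R.conj x) = t₂} * ∑ᶠ s ∈ B.suffixSet m n t₁ t₂, w s := by
  have hset : ∀ s ∈ B.suffixSet m n t₁ t₂, {x | x ∈ {x | B.tau m (R.conj x) = t₁ ∧
      B.tau n (R.conj x) = t₂} ∧ B.suffix m n (R.conj x) = s} =
      {x | B.tau n (R.conj x) = t₂ ∧ B.suffix m n (R.conj x) = s} := by
    intro s hs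
    ext x
    constructor
    · exact fun h => ⟨h.1.2, h.2⟩
    · rintro ⟨h1, rfl⟩
      exact ⟨⟨(suffix_mem_suffixSet_iff hq hmn h1).1 hs, h1⟩, rfl⟩
  have hint : Integrable (fun x => w (B.suffix m n (R.conj x))) μ :=
    Integrable.of_bound (R.continuous_comp (isLocallyConstant_suffix hq hmn) w).measurable.aestronglyMeasurable
      1 (ae_of_all _ fun x => hw _)
  have hfin := suffixSet_finite hq hmn t₁ t₂
  rw [setIntegral_eq_sum_fiber hint hfin.toFinset (fun x => B.suffix m n (R.conj x)) (fun x hx => ?_)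
    fun s hs => ?_, finsum_mem_eq_finite_toFinset_sum _ hfin, Finset.mul_sum, Finset.mul_sum]
  · refine Finset.sum_congr rfl fun s hs => ?_
    rw [hfin.mem_toFinset] at hs
    rw [hset s hs, setIntegral_congr_fun (g := fun _ => w s) (R.measurableSet_level hq hmn t₂ s)
      fun x hx => congrArg w hx.2, setIntegral_const, Complex.real_smul, ← mul_assoc,
      ← R.measureReal_suffix_eq hq hT hmn t₂ (Finset.mem_range.1 (suffixSet_subset hq hmn _ _ hs))]
    push_cast
    rfl
  · rw [hfin.mem_toFinset, suffix_mem_suffixSet_iff hq hmn hx.2]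
    exact hx.1
  · rw [hset s (hfin.mem_toFinset.1 hs)]
    exact R.measurableSet_level hq hmn t₂ s

/-- An eigenfunction is, up to the height in the towers of high level, close to a function of the
tower. -/
theorem exists_tower_approx [CompactSpace X] [NormalSpace X] [μ.WeaklyRegular] {q : ℕ → ℕ}
    (hq : B.IsToeplitz q) (hT : MeasurePreserving T μ μ) {lam : ℂ} (hlam : ‖lam‖ = 1) {f : X → ℂ}
    (hfm : Measurable f) (hf : Integrable f μ) (hf1 : ∀ᵐ x ∂μ, ‖f x‖ = 1)
    (hfT : ∀ᵐ x ∂μ, f (T x) = lam * f x) {ε : ℝ} (hε : 0 < ε) :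
    ∃ M, ∀ m ≥ M, ∃ c : B.V m → ℂ, (∀ t, ‖c t‖ ≤ 1) ∧
      Integrable (fun x => lam ^ B.suffix 0 m (R.conj x) * f x - c (B.tau m (R.conj x))) μ ∧
      ∫ x, ‖lam ^ B.suffix 0 m (R.conj x) * f x - c (B.tau m (R.conj x))‖ ∂μ ≤ ε := by
  -- The quarter compensates the factor 4 in `integral_norm_sub_average_le`.
  obtain ⟨g, hfg, hg⟩ := hf.exists_boundedContinuous_integral_sub_le (ε := ε / 4) (by positivity)
  obtain ⟨M, hM⟩ := R.exists_norm_sub_le hq g.continuous (ε := ε / 4) (by positivity)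
  refine ⟨M, fun m hm => ?_⟩
  have htow := R.isTower hq m
  have hFm : Measurable fun x => lam ^ B.suffix 0 m (R.conj x) * f x :=
    (R.continuous_comp (isLocallyConstant_suffix hq m.zero_le) (lam ^ ·)).measurable.mul hfm
  have hF1 : ∀ᵐ x ∂μ, ‖lam ^ B.suffix 0 m (R.conj x) * f x‖ ≤ 1 := by
    filter_upwards [hf1] with x hx
    rw [norm_mul, norm_pow, hlam, one_pow, hx, one_mul]
  have hF : Integrable (fun x => lam ^ B.suffix 0 m (R.conj x) * f x) μ :=
    Integrable.of_bound hFm.aestronglyMeasurable 1 hF1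
  let A : B.V m → Set X := fun t => {x | B.tau m (R.conj x) = t}
  let J : B.V m → ℂ := fun t => ∫ x in A t, lam ^ B.suffix 0 m (R.conj x) * f x ∂μ
  -- On a null tower the integral vanishes too, and the average is 0 by convention.
  let c : B.V m → ℂ := fun t => (μ.real (A t) : ℂ)⁻¹ * J t
  have hJle : ∀ t, ‖J t‖ ≤ μ.real (A t) := by
    intro t
    have := norm_setIntegral_le_of_norm_le_const_ae (μ := μ) (s := A t) (measure_lt_top μ _)
      (ae_restrict_of_ae hF1)
    simpa using this
  have hc1 : ∀ t, ‖c t‖ ≤ 1 := by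
    intro t
    rw [norm_mul, norm_inv, Complex.norm_real, Real.norm_of_nonneg measureReal_nonneg]
    exact inv_mul_le_one_of_le₀ (hJle t) measureReal_nonneg
  have hcint : Integrable (fun x => lam ^ B.suffix 0 m (R.conj x) * f x -
      c (B.tau m (R.conj x))) μ :=
    hF.sub (Integrable.of_bound (R.continuous_comp (isLocallyConstant_tau m)
      c).measurable.aestronglyMeasurable 1 (ae_of_all _ fun x => hc1 _))
  refine ⟨c, hc1, hcint, ?_⟩
  refine (htow.integral_norm_sub_average_le hT measurableEmbedding
    (R.measurableSet_level hq m.zero_le) hlam hf hg hF ?_ hfg (hM m hm) (c := c) (fun t => ?_)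
    hcint).trans (by linarith)
  · filter_upwards [hfT] with x hx hx'
    rw [hx, ← (htow.of_pos x hx').1, pow_succ]
    ring
  · by_cases h0 : μ.real (A t) = 0
    · have h1 : J t = 0 := norm_le_zero_iff.1 ((hJle t).trans h0.le)
      change _ = J t
      rw [h1, show c t = 0 by simp [c, h1], mul_zero]
    · exact mul_inv_cancel_left₀ (Complex.ofReal_ne_zero.2 h0) _

end Representation

end OrderedBratteliDiagram

/-! ### Weak convergence from the mean ergodic theorem. -/

/-- A bounded sequence of almost fixed vectors of an isometry without nonzero fixed vectors tends
weakly to zero. -/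
theorem tendsto_inner_zero_of_almost_fixed {H : Type*} [NormedAddCommGroup H]
    [InnerProductSpace ℂ H] [CompleteSpace H] (U : H →L[ℂ] H)
    (hU : ∀ x y, inner ℂ (U x) (U y) = inner ℂ x y) (hfix : ∀ x, U x = x → x = 0) {g : ℕ → H}
    (hbd : ∀ n, ‖g n‖ ≤ 1) (hg : Tendsto (fun n => ‖U (g n) - g n‖) atTop (𝓝 0)) (h : H) :
    Tendsto (fun n => inner ℂ h (g n)) atTop (𝓝 0) := by
  have hnorm : ∀ x, ‖U x‖ = ‖x‖ := fun x => by
    rw [@norm_eq_sqrt_re_inner ℂ, @norm_eq_sqrt_re_inner ℂ, hU]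
  have hnormk : ∀ (k : ℕ) x, ‖U^[k] x‖ = ‖x‖ := by
    intro k x
    induction k with
    | zero => rfl
    | succ k ih => rw [Function.iterate_succ_apply', hnorm, ih]
  -- Telescoping: by isometry, each application of `U` to `h` costs at most ‖h‖ ‖U g - g‖. So `h`
  -- may be replaced by its Birkhoff average, whose norm is small.
  have hstep : ∀ (k n : ℕ), ‖inner ℂ (U^[k] h) (g n) - inner ℂ h (g n)‖ ≤
      k * (‖h‖ * ‖U (g n) - g n‖) := by
    intro k n
    induction k with
    | zero => simp
    | succ k ih =>
      have h1 : (inner ℂ (U^[k + 1] h) (g n) : ℂ) - inner ℂ (U^[k] h) (g n) =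
          inner ℂ (U^[k + 1] h) (g n - U (g n)) := by
        rw [inner_sub_right, Function.iterate_succ_apply', hU]
      calc _ ≤ ‖(inner ℂ (U^[k + 1] h) (g n) : ℂ) - inner ℂ (U^[k] h) (g n)‖ +
            ‖(inner ℂ (U^[k] h) (g n) : ℂ) - inner ℂ h (g n)‖ :=
            norm_sub_le_norm_sub_add_norm_sub _ _ _
        _ ≤ ‖h‖ * ‖U (g n) - g n‖ + k * (‖h‖ * ‖U (g n) - g n‖) := by
            refine add_le_add ?_ ih
            rw [h1]
            refine (norm_inner_le_norm _ _).trans ?_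
            rw [hnormk, norm_sub_rev]
        _ = _ := by push_cast; ring
  have hmean : Tendsto (fun N => birkhoffAverage ℂ U id N h) atTop (𝓝 0) := by
    have h1 := U.tendsto_birkhoffAverage_orthogonalProjection
      (U.opNorm_le_bound zero_le_one fun x => by rw [hnorm, one_mul]) h
    have h2 : ∀ v ∈ LinearMap.eqLocus (U : H →ₗ[ℂ] H) (1 : H →L[ℂ] H), v = 0 :=
      fun v hv => hfix v hv
    rwa [h2 _ (Subtype.property _)] at h1
  rw [Metric.tendsto_atTop]
  intro ε hε
  obtain ⟨N₀, hN₀⟩ := Metric.tendsto_atTop.1 hmean (ε / 2) (half_pos hε)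
  have hN := hN₀ (N₀ + 1) (by omega)
  set N := N₀ + 1
  rw [dist_zero_right] at hN
  have hNpos : (0 : ℝ) < N := by positivity
  have hlim : Tendsto (fun n => N * (‖h‖ * ‖U (g n) - g n‖)) atTop (𝓝 0) := by
    simpa using (hg.const_mul ‖h‖).const_mul (N : ℝ)
  obtain ⟨n₀, hn₀⟩ := eventually_atTop.1 (hlim.eventually_lt_const (half_pos hε))
  refine ⟨n₀, fun n hn => ?_⟩
  rw [dist_zero_right]
  have havg : ‖(inner ℂ (birkhoffAverage ℂ U id N h) (g n) : ℂ) - inner ℂ h (g n)‖ ≤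
      N * (‖h‖ * ‖U (g n) - g n‖) := by
    have hNC : (N : ℂ) ≠ 0 := Nat.cast_ne_zero.2 (by omega)
    have h1 : (inner ℂ (birkhoffAverage ℂ U id N h) (g n) : ℂ) - inner ℂ h (g n) =
        (N : ℂ)⁻¹ * ∑ k ∈ Finset.range N, (inner ℂ (U^[k] h) (g n) - inner ℂ h (g n)) := by
      rw [birkhoffAverage, birkhoffSum, inner_smul_left, sum_inner, Finset.sum_sub_distrib, mul_sub]
      simp [hNC]
    rw [h1, norm_mul, norm_inv, Complex.norm_natCast, inv_mul_le_iff₀ hNpos]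
    refine (norm_sum_le _ _).trans ((Finset.sum_le_card_nsmul _ _
      (N * (‖h‖ * ‖U (g n) - g n‖)) fun k hk => ?_).trans ?_)
    · refine (hstep k n).trans ?_
      have : (k : ℝ) ≤ N := Nat.cast_le.2 (Finset.mem_range.1 hk).le
      gcongr
    · simp
  calc ‖(inner ℂ h (g n) : ℂ)‖
      ≤ ‖(inner ℂ (birkhoffAverage ℂ U id N h) (g n) : ℂ)‖ +
        ‖(inner ℂ (birkhoffAverage ℂ U id N h) (g n) : ℂ) - inner ℂ h (g n)‖ := by
        refine (norm_le_insert' _ (inner ℂ (birkhoffAverage ℂ U id N h) (g n) : ℂ)).trans ?_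
        rw [norm_sub_rev (inner ℂ h (g n) : ℂ)]
    _ < ε / 2 + ε / 2 := by
        refine add_lt_add_of_lt_of_le ?_ (havg.trans (hn₀ n hn).le)
        refine ((norm_inner_le_norm _ _).trans
          (mul_le_of_le_one_right (norm_nonneg _) (hbd n))).trans_lt hN
    _ = ε := add_halves ε

/-! ### Necessary conditions for an eigenvalue. -/

namespace OrderedBratteliDiagram.Representation

variable {B : OrderedBratteliDiagram} {X : Type*} [TopologicalSpace X] {T : X ≃ₜ X}
  [MeasurableSpace X] [BorelSpace X] {μ : Measure X}
  [IsProbabilityMeasure μ]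

/-- The order of `lam ^ p_m` is at most the number of vertices of large levels if `lam` is an
eigenvalue. -/
theorem eventually_div_gcd_le_card (R : B.Representation T) [CompactSpace X] [NormalSpace X]
    [μ.WeaklyRegular] {q : ℕ → ℕ} (hq : B.IsToeplitz q) (hT : MeasurePreserving T μ μ) {lam : ℂ} {b : ℕ} (hb : 0 < b)
    (hlam : IsPrimitiveRoot lam b) {f : X → ℂ}
    (hfm : Measurable f) (hf : Integrable f μ) (hf1 : ∀ᵐ x ∂μ, ‖f x‖ = 1)
    (hfT : ∀ᵐ x ∂μ, f (T x) = lam * f x) :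
    ∀ᶠ m in atTop, b / b.gcd (pSeq q m) ≤ Fintype.card (B.V m) := by
  obtain ⟨x₀⟩ := nonempty_of_isProbabilityMeasure μ
  have hlam1 : ‖lam‖ = 1 := hlam.norm'_eq_one hb.ne'
  obtain ⟨η, hη, hsep⟩ := exists_le_norm_sub_one b hb
  have hbR : (0 : ℝ) < b := Nat.cast_pos.2 hb
  obtain ⟨M, hM⟩ := R.exists_tower_approx hq hT hlam1 hfm hf hf1 hfT
    -- The order of λ^{p_m} is at most `b`, so this meets the threshold η/2/r for every `m`; the
    -- last halving gives strictness.
    (ε := η / 2 / b / 2) (by positivity)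
  refine eventually_atTop.2 ⟨M, fun m hm => ?_⟩
  obtain ⟨c, -, hcint, hc⟩ := hM m hm
  have hp := pSeq_pos hq (R.conj x₀) m
  have hz : IsPrimitiveRoot (lam ^ pSeq q m) (b / b.gcd (pSeq q m)) := by
    have h := IsPrimitiveRoot.orderOf (lam ^ pSeq q m)
    rwa [orderOf_pow' _ hp.ne', ← hlam.eq_orderOf] at h
  have hr : 0 < b / b.gcd (pSeq q m) :=
    Nat.div_pos (Nat.le_of_dvd hb (Nat.gcd_dvd_left _ _)) (Nat.gcd_pos_of_pos_left _ hb)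
  refine le_of_rotation_invariant (hT.iterate (pSeq q m)) ?_ ?_ hz hr ?_ hη ?_ hcint
    (hc.trans_lt ?_)
  · exact (R.continuous_comp (isLocallyConstant_suffix hq m.zero_le) (lam ^ ·)).measurable.mul hfm
  · filter_upwards [hf1] with x hx
    rw [norm_mul, norm_pow, hlam1, one_pow, hx, one_mul]
  · filter_upwards [ae_iterate_eigenfunction hT hfT (pSeq q m)] with x hx
    have h1 : B.suffix 0 m (R.conj (T^[pSeq q m] x)) = B.suffix 0 m (R.conj x) :=
      (R.isTower hq m).iterate_height x
    rw [hx, h1]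
    ring
  · refine fun k hk => hsep _ ?_ hk
    rw [pow_right_comm, pow_right_comm lam, hlam.pow_eq_one, one_pow, one_pow]
  · have hrb : ((b / b.gcd (pSeq q m) : ℕ) : ℝ) ≤ b := Nat.cast_le.2 (Nat.div_le_self _ _)
    calc η / 2 / b / 2 < η / 2 / b := half_lt_self (by positivity)
      _ ≤ _ := by gcongr

/-- The exponential sums associated with an eigenvalue are almost maximal. -/
theorem exists_forall_sum_norm_ge (R : B.Representation T) [CompactSpace X] [NormalSpace X]
    [μ.WeaklyRegular] {q : ℕ → ℕ} (hq : B.IsToeplitz q) (hT : MeasurePreserving T μ μ) {lam : ℂ} (hlam : ‖lam‖ = 1) {f : X → ℂ}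
    (hfm : Measurable f) (hf : Integrable f μ) (hf1 : ∀ᵐ x ∂μ, ‖f x‖ = 1)
    (hfT : ∀ᵐ x ∂μ, f (T x) = lam * f x) {ε : ℝ} (hε : 0 < ε) :
    ∃ M, ∀ m n, M ≤ m → m ≤ n → ∀ t₂ : B.V n,
      μ.real {x | B.tau n (R.conj x) = t₂} - ε ≤ μ.real {x | B.tau n (R.conj x) = t₂} *
        ∑ t₁ : B.V m, ‖∑ᶠ s ∈ B.suffixSet m n t₁ t₂, lam ^ (pSeq q m * s)‖ / (qProd q m n : ℝ) := by
  classical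
  obtain ⟨x₀⟩ := nonempty_of_isProbabilityMeasure μ
  obtain ⟨M, hM⟩ := R.exists_tower_approx hq hT hlam hfm hf hf1 hfT (ε := ε / 3) (by positivity)
  refine ⟨M, fun m n hm hmn t₂ => ?_⟩
  obtain ⟨c, hc1, hcint, hc⟩ := hM m hm
  obtain ⟨c', hc'1, hcint', hc'⟩ := hM n (hm.trans hmn)
  set P := μ.real {x | B.tau n (R.conj x) = t₂} with hP
  have hPset := R.measurableSet_fiber (isLocallyConstant_tau n) t₂
  have hQ : (0 : ℝ) < qProd q m n := Nat.cast_pos.2 ((Nat.zero_le _).trans_lt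
    (suffix_lt hq hmn (R.conj x₀)))
  have hFint : ∀ k, Integrable (fun x => lam ^ B.suffix 0 k (R.conj x) * f x) μ := fun k =>
    Integrable.of_bound ((R.continuous_comp (isLocallyConstant_suffix hq k.zero_le)
      (lam ^ ·)).measurable.mul hfm).aestronglyMeasurable 1 (by
        filter_upwards [hf1] with x hx
        rw [norm_mul, norm_pow, hlam, one_pow, hx, one_mul])
  have hw : ∀ s, ‖lam ^ (pSeq q m * s)‖ ≤ 1 := fun s => by rw [norm_pow, hlam, one_pow]
  have hwm : Measurable fun x => lam ^ (pSeq q m * B.suffix m n (R.conj x)) :=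
    (R.continuous_comp (isLocallyConstant_suffix hq hmn) fun s => lam ^ (pSeq q m * s)).measurable
  set J := ∫ x in {x | B.tau n (R.conj x) = t₂}, lam ^ B.suffix 0 n (R.conj x) * f x ∂μ with hJ
  -- The integrand has modulus one, so its approximation on the tower must have modulus near one on
  -- average.
  have hP1 : P - ε / 3 ≤ P * ‖c' t₂‖ := by
    have h1 : P - P * ‖c' t₂‖ = ∫ x in {x | B.tau n (R.conj x) = t₂},
        (‖lam ^ B.suffix 0 n (R.conj x) * f x‖ - ‖c' (B.tau n (R.conj x))‖) ∂μ := by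
      rw [setIntegral_congr_ae (g := fun x => 1 - ‖c' t₂‖) hPset (by
        filter_upwards [hf1] with x hx hx'
        rw [show B.tau n (R.conj x) = t₂ from hx', norm_mul, norm_pow, hlam, one_pow, hx,
          one_mul]), setIntegral_const, smul_eq_mul, mul_sub, mul_one]
    have h2 : P - P * ‖c' t₂‖ ≤ ε / 3 := by
      rw [h1]
      refine (le_trans ?_ (setIntegral_le_integral (s := {x | B.tau n (R.conj x) = t₂})
        hcint'.norm (ae_of_all _ fun _ => norm_nonneg _))).trans hc'
      refine integral_mono ((hFint n).norm.sub ?_).integrableOn hcint'.norm.integrableOn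
        fun x => norm_sub_norm_le _ _
      exact Integrable.of_bound (R.continuous_comp (isLocallyConstant_tau n)
        fun t => ‖c' t‖).measurable.aestronglyMeasurable 1 (ae_of_all _ fun x => by
          simpa using hc'1 _)
    linarith
  have hP2 : P * ‖c' t₂‖ - ε / 3 ≤ ‖J‖ := by
    have h3 : J - P * c' t₂ = ∫ x in {x | B.tau n (R.conj x) = t₂},
        (lam ^ B.suffix 0 n (R.conj x) * f x - c' (B.tau n (R.conj x))) ∂μ := by
      rw [setIntegral_congr_fun (g := fun x => lam ^ B.suffix 0 n (R.conj x) * f x - c' t₂) hPset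
        fun x (hx : B.tau n (R.conj x) = t₂) => by simp only [hx],
        integral_sub (hFint n).integrableOn (integrable_const _), setIntegral_const,
        Complex.real_smul]
    have h2 : ‖J - P * c' t₂‖ ≤ ε / 3 := by
      rw [h3]
      exact (norm_integral_le_integral_norm _).trans
        ((setIntegral_le_integral hcint'.norm (ae_of_all _ fun _ => norm_nonneg _)).trans hc')
    have h4 : ‖(P : ℂ) * c' t₂‖ = P * ‖c' t₂‖ := by
      rw [norm_mul, Complex.norm_real, Real.norm_of_nonneg measureReal_nonneg]
    have h5 := norm_le_insert' ((P : ℂ) * c' t₂) J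
    rw [norm_sub_rev, h4] at h5
    linarith
  have hgi : Integrable (fun x => lam ^ (pSeq q m * B.suffix m n (R.conj x)) *
      c (B.tau m (R.conj x))) μ := by
    refine Integrable.of_bound (hwm.mul (R.continuous_comp (isLocallyConstant_tau m)
      c).measurable).aestronglyMeasurable 1 (ae_of_all _ fun x => ?_)
    rw [norm_mul]
    exact mul_le_one₀ (hw _) (norm_nonneg _) (hc1 _)
  set S := ∫ x in {x | B.tau n (R.conj x) = t₂}, lam ^ (pSeq q m * B.suffix m n (R.conj x)) *
      c (B.tau m (R.conj x)) ∂μ with hS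
  -- Factoring s_n as s_m + p_m s_{m,n} leaves the level-`m` approximation error, multiplied by a
  -- unit factor.
  have hJS : ‖J - S‖ ≤ ε / 3 := by
    rw [hJ, hS, ← integral_sub (hFint n).integrableOn hgi.integrableOn]
    refine (norm_integral_le_integral_norm _).trans (le_trans ?_ hc)
    refine le_trans (le_of_eq ?_) (setIntegral_le_integral (s := {x | B.tau n (R.conj x) = t₂})
      hcint.norm (ae_of_all _ fun _ => norm_nonneg _))
    refine integral_congr_ae (ae_of_all _ fun x => ?_)
    simp only []
    rw [suffix_zero_eq hq hmn, add_comm, pow_add, mul_assoc, ← mul_sub, norm_mul, norm_pow, hlam,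
      one_pow, one_mul]
  have hSle : ‖S‖ ≤ P * ∑ t₁ : B.V m,
      ‖∑ᶠ s ∈ B.suffixSet m n t₁ t₂, lam ^ (pSeq q m * s)‖ / (qProd q m n : ℝ) := by
    have hset : ∀ t₁, {x | x ∈ {x | B.tau n (R.conj x) = t₂} ∧ B.tau m (R.conj x) = t₁} =
        {x | B.tau m (R.conj x) = t₁ ∧ B.tau n (R.conj x) = t₂} := fun t₁ => by
      ext x
      exact and_comm
    have hmeas : ∀ t₁, MeasurableSet {x | B.tau m (R.conj x) = t₁ ∧ B.tau n (R.conj x) = t₂} :=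
      fun t₁ => (R.measurableSet_fiber (isLocallyConstant_tau m) t₁).inter hPset
    rw [hS, setIntegral_eq_sum_fiber hgi Finset.univ (fun x => B.tau m (R.conj x))
      (fun _ _ => Finset.mem_univ _) fun t₁ _ => by rw [hset]; exact hmeas t₁, Finset.mul_sum]
    refine (norm_sum_le _ _).trans (Finset.sum_le_sum fun t₁ _ => ?_)
    rw [hset, setIntegral_congr_fun (g := fun x => lam ^ (pSeq q m * B.suffix m n (R.conj x)) *
      c t₁) (hmeas t₁) fun x hx => by simp only [show B.tau m (R.conj x) = t₁ from hx.1],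
      integral_mul_const, norm_mul]
    refine (mul_le_of_le_one_right (norm_nonneg _) (hc1 _)).trans (le_of_eq ?_)
    have h1 := congrArg norm (R.setIntegral_suffix hq hT hmn t₁ t₂ hw)
    rw [norm_mul, norm_mul, Complex.norm_real, Real.norm_of_nonneg measureReal_nonneg,
      Complex.norm_natCast] at h1
    rw [← mul_div_assoc, eq_div_iff hQ.ne', mul_comm]
    exact h1
  have hJle : ‖J‖ ≤ ‖S‖ + ‖J - S‖ := norm_le_insert' _ _
  linarith

end OrderedBratteliDiagram.Representation

/-! ### From large exponential sums to an eigenfunction. -/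

theorem MeasureTheory.Lp.norm_le_of_indicator {X : Type*} [MeasurableSpace X] {μ : Measure X}
    [IsProbabilityMeasure μ] (v : Lp ℂ 2 μ) {S : Set X} (hS : MeasurableSet S) {C : ℝ} (hC : 0 ≤ C)
    (hb : ∀ᵐ x ∂μ, ‖v x‖ ≤ C) (h : ∀ᵐ x ∂μ, x ∉ S → v x = 0) :
    ‖v‖ ≤ C * √(μ.real S) := by
  have h1 : ‖v‖ ≤ ‖indicatorConstLp 2 hS (measure_ne_top μ S) C‖ := by
    refine Lp.norm_le_norm_of_ae_le ?_
    filter_upwards [hb, h, indicatorConstLp_coeFn (p := 2) (hs := hS) (hμs := measure_ne_top μ S)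
      (c := C)] with x h1 h2 h3
    rw [h3]
    by_cases hx : x ∈ S
    · rw [Set.indicator_of_mem hx, Real.norm_of_nonneg hC]
      exact h1
    · simp [h2 hx, hx]
  refine h1.trans_eq ?_
  rw [norm_indicatorConstLp two_ne_zero ENNReal.ofNat_ne_top, Real.norm_of_nonneg hC,
    Real.sqrt_eq_rpow]
  simp

namespace OrderedBratteliDiagram.Representation

variable {B : OrderedBratteliDiagram} {X : Type*} [TopologicalSpace X] {T : X ≃ₜ X}
  [MeasurableSpace X] [BorelSpace X] {μ : Measure X} [IsProbabilityMeasure μ]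

/-- Since all towers have the same height, they merge into a single tower, indexed by a one-point
type, whose p_n levels have equal measure. -/
theorem measureReal_bottom (R : B.Representation T) {q : ℕ → ℕ} (hq : B.IsToeplitz q)
    (hT : MeasurePreserving T μ μ) (n : ℕ) :
    pSeq q n * μ.real {x | B.suffix 0 n (R.conj x) = 0} = 1 := by
  obtain ⟨x₀⟩ := nonempty_of_isProbabilityMeasure μ
  have htow := R.isTower hq n
  have h : IsTower T (fun _ => ()) (fun x => B.suffix 0 n (R.conj x)) (pSeq q n) :=
    ⟨htow.lt, fun x hx => ⟨(htow.of_pos x hx).1, rfl⟩, htow.of_eq_zero⟩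
  have := h.measureReal_tower hT measurableEmbedding (μ := μ) (fun _ k => by
    simpa using R.measurableSet_fiber (isLocallyConstant_suffix hq n.zero_le) k) ()
    (pSeq_pos hq (R.conj x₀) n)
  simpa using this.symm

/-- If the exponential sums do not tend to zero then `lam` is an eigenvalue. -/
theorem isMeasurableEigenvalue_of_le_sum (R : B.Representation T) {q : ℕ → ℕ}
    (hq : B.IsToeplitz q) (hT : MeasurePreserving T μ μ) (hp : Tendsto (pSeq q) atTop atTop)
    {lam : ℂ} (hlam : ‖lam‖ = 1) {m : ℕ} {n : ℕ → ℕ} (hmn : ∀ k, m ≤ n k)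
    (hn : Tendsto n atTop atTop) (t₂ : ∀ k, B.V (n k)) {δ κ : ℝ} (hδ : 0 < δ) (hκ : 0 < κ)
    (ht₂ : ∀ k, δ ≤ μ.real {x | B.tau (n k) (R.conj x) = t₂ k})
    (hsum : ∀ k, κ ≤ ∑ t₁ : B.V m, ‖∑ᶠ s ∈ B.suffixSet m (n k) t₁ (t₂ k),
      lam ^ (-((pSeq q m * s : ℕ) : ℤ))‖ / (qProd q m (n k) : ℝ)) :
    IsMeasurableEigenvalue T μ lam := by
  classical
  obtain ⟨x₀⟩ := nonempty_of_isProbabilityMeasure μ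
  by_contra hcon
  have hlam0 : lam ≠ 0 := norm_pos_iff.1 (hlam ▸ one_pos)
  have hinv1 : ‖lam⁻¹‖ = 1 := by rw [norm_inv, hlam, inv_one]
  let φ : ∀ l, B.V l → X → ℂ := fun l t x =>
    if B.tau l (R.conj x) = t then lam⁻¹ ^ B.suffix 0 l (R.conj x) else 0
  have hφ1 : ∀ l t x, ‖φ l t x‖ ≤ 1 := by
    intro l t x
    by_cases h : B.tau l (R.conj x) = t
    · simp only [φ, if_pos h, norm_pow, hinv1, one_pow, le_refl]
    · simp only [φ, if_neg h, norm_zero, zero_le_one]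
  have hφm : ∀ l t, Measurable (φ l t) := fun l t =>
    (R.continuous_comp ((isLocallyConstant_tau l).prodMk
      (isLocallyConstant_suffix hq l.zero_le)) fun i => if i.1 = t then lam⁻¹ ^ i.2 else 0).measurable
  have hφ : ∀ l t, MemLp (φ l t) 2 μ := fun l t =>
    MemLp.of_bound (hφm l t).aestronglyMeasurable 1 (ae_of_all _ (hφ1 l t))
  let G : ∀ l, B.V l → Lp ℂ 2 μ := fun l t => (hφ l t).toLp _
  let K := Lp.compMeasurePreservingₗᵢ (E := ℂ) (p := 2) ℂ T hT
  -- The fixed vectors of this isometry are exactly the eigenfunctions for λ, so by assumption there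
  -- is no nonzero one.
  let U : Lp ℂ 2 μ →L[ℂ] Lp ℂ 2 μ := lam⁻¹ • K.toContinuousLinearMap
  have hUapp : ∀ v : Lp ℂ 2 μ, ∀ᵐ x ∂μ, U v x = lam⁻¹ * v (T x) := by
    intro v
    filter_upwards [Lp.coeFn_smul lam⁻¹ (K v), Lp.coeFn_compMeasurePreserving v hT] with x h1 h2
    change (lam⁻¹ • K v : Lp ℂ 2 μ) x = _
    rw [h1, Pi.smul_apply, smul_eq_mul]
    exact congrArg _ h2
  have hU : ∀ v w, (inner ℂ (U v) (U w) : ℂ) = inner ℂ v w := by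
    intro v w
    change (inner ℂ (lam⁻¹ • K v) (lam⁻¹ • K w) : ℂ) = _
    rw [inner_smul_left, inner_smul_right, LinearIsometry.inner_map_map, ← mul_assoc,
      Complex.conj_mul', hinv1]
    simp
  have hfix : ∀ v, U v = v → v = 0 := by
    intro v hv
    by_contra hne
    refine hcon ⟨v, Lp.memLp v, fun h0 => hne ((Lp.eq_zero_iff_ae_eq_zero).2 h0), ?_⟩
    filter_upwards [hUapp v] with x hx
    rw [hv] at hx
    rw [hx, mul_inv_cancel_left₀ hlam0]
  have hG1 : ∀ l t, ‖G l t‖ ≤ 1 := by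
    intro l t
    have h := Lp.norm_le_of_indicator (G l t) MeasurableSet.univ zero_le_one (by
      filter_upwards [(hφ l t).coeFn_toLp] with x hx
      rw [hx]
      exact hφ1 l t x) (ae_of_all _ fun x hx => absurd (Set.mem_univ x) hx)
    simpa using h
  -- The relation φ∘T = λφ can fail only at the bottom level, where the defect is at most 2.
  have hGU : ∀ l t, ‖U (G l t) - G l t‖ ≤ 2 * √(μ.real {x | B.suffix 0 l (R.conj x) = 0}) := by
    intro l t
    have hval : ∀ᵐ x ∂μ, (U (G l t) - G l t) x = lam⁻¹ * φ l t (T x) - φ l t x := by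
      filter_upwards [Lp.coeFn_sub (U (G l t)) (G l t), hUapp (G l t), (hφ l t).coeFn_toLp,
        hT.quasiMeasurePreserving.ae_eq_comp (hφ l t).coeFn_toLp] with x h1 h2 h3 h4
      rw [h1, Pi.sub_apply, h2, h3]
      exact congrArg (fun u => lam⁻¹ * u - φ l t x) h4
    refine Lp.norm_le_of_indicator _
      (R.measurableSet_fiber (isLocallyConstant_suffix hq l.zero_le) 0) zero_le_two ?_ ?_
    · filter_upwards [hval] with x hx
      rw [hx]
      calc _ ≤ ‖lam⁻¹ * φ l t (T x)‖ + ‖φ l t x‖ := norm_sub_le _ _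
        _ ≤ 1 + 1 := by
          rw [norm_mul, hinv1, one_mul]
          exact add_le_add (hφ1 _ _ _) (hφ1 _ _ _)
        _ = 2 := by norm_num
    · filter_upwards [hval] with x hx hx0
      obtain ⟨h1, h2⟩ := (R.isTower hq l).of_pos x (Nat.pos_of_ne_zero hx0)
      have h3 : φ l t x = lam⁻¹ * φ l t (T x) := by
        simp only [φ]
        rw [h2, ← h1, pow_succ]
        split_ifs <;> ring
      rw [hx, h3, sub_self]
  -- The powers of λ with exponent s_m cancel in the inner product, leaving λ^{-p_m s_{m,n}}, whose
  -- integral over the intersection of the two towers is an exponential sum.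
  have hinner : ∀ k (t₁ : B.V m), ‖(inner ℂ (G m t₁) (G (n k) (t₂ k)) : ℂ)‖ =
      μ.real {x | B.tau (n k) (R.conj x) = t₂ k} *
      (‖∑ᶠ s ∈ B.suffixSet m (n k) t₁ (t₂ k), lam ^ (-((pSeq q m * s : ℕ) : ℤ))‖ /
        (qProd q m (n k) : ℝ)) := by
    intro k t₁
    have hQ : (0 : ℝ) < qProd q m (n k) := Nat.cast_pos.2 ((Nat.zero_le _).trans_lt
      (suffix_lt hq (hmn k) (R.conj x₀)))
    have hset : MeasurableSet {x | B.tau m (R.conj x) = t₁ ∧ B.tau (n k) (R.conj x) = t₂ k} :=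
      (R.measurableSet_fiber (isLocallyConstant_tau m) t₁).inter
        (R.measurableSet_fiber (isLocallyConstant_tau (n k)) (t₂ k))
    have h1 : (inner ℂ (G m t₁) (G (n k) (t₂ k)) : ℂ) =
        ∫ x in {x | B.tau m (R.conj x) = t₁ ∧ B.tau (n k) (R.conj x) = t₂ k},
          lam ^ (-((pSeq q m * B.suffix m (n k) (R.conj x) : ℕ) : ℤ)) ∂μ := by
      rw [L2.inner_def, ← integral_indicator hset]
      refine integral_congr_ae ?_
      filter_upwards [(hφ m t₁).coeFn_toLp, (hφ (n k) (t₂ k)).coeFn_toLp] with x h1 h2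
      rw [h1, h2, RCLike.inner_apply]
      by_cases hx1 : B.tau m (R.conj x) = t₁
      · by_cases hx2 : B.tau (n k) (R.conj x) = t₂ k
        · rw [Set.indicator_of_mem (show x ∈ {x | B.tau m (R.conj x) = t₁ ∧
            B.tau (n k) (R.conj x) = t₂ k} from ⟨hx1, hx2⟩)]
          simp only [φ, if_pos hx1, if_pos hx2]
          rw [suffix_zero_eq hq (hmn k), pow_add, mul_right_comm, Complex.mul_conj', norm_pow,
            hinv1, zpow_neg, zpow_natCast, inv_pow lam (_ * _)]
          simp
        · rw [Set.indicator_of_notMem (fun h => hx2 h.2)]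
          simp only [φ, if_neg hx2, zero_mul]
      · rw [Set.indicator_of_notMem (fun h => hx1 h.1)]
        simp only [φ, if_neg hx1, map_zero, mul_zero]
    have h2 := congrArg norm (R.setIntegral_suffix hq hT (hmn k) t₁ (t₂ k)
      (w := fun s => lam ^ (-((pSeq q m * s : ℕ) : ℤ))) fun s => by
        rw [norm_zpow, hlam, one_zpow])
    rw [norm_mul, norm_mul, Complex.norm_real, Real.norm_of_nonneg measureReal_nonneg,
      Complex.norm_natCast] at h2
    rw [h1, ← mul_div_assoc, eq_div_iff hQ.ne', mul_comm]
    exact h2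
  have hlim : Tendsto (fun k => ‖U (G (n k) (t₂ k)) - G (n k) (t₂ k)‖) atTop (𝓝 0) := by
    have h1 : Tendsto (fun k => 2 * √((pSeq q (n k) : ℝ)⁻¹)) atTop (𝓝 0) := by
      have h2 := (tendsto_inv_atTop_zero.comp
        ((tendsto_natCast_atTop_atTop (R := ℝ)).comp (hp.comp hn))).sqrt.const_mul 2
      simpa using h2
    refine squeeze_zero (fun _ => norm_nonneg _) (fun k => ?_) h1
    refine (hGU _ _).trans_eq ?_
    rw [eq_inv_of_mul_eq_one_right (R.measureReal_bottom hq hT (n k))]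
  have hzero : Tendsto (fun k => ∑ t₁ : B.V m, ‖(inner ℂ (G m t₁) (G (n k) (t₂ k)) : ℂ)‖) atTop
      (𝓝 0) := by
    have h1 := tendsto_finsetSum Finset.univ fun (t₁ : B.V m) _ =>
      (tendsto_inner_zero_of_almost_fixed U hU hfix (fun k => hG1 (n k) (t₂ k)) hlim (G m t₁)).norm
    simpa using h1
  obtain ⟨k, hk⟩ := (hzero.eventually_lt_const (mul_pos hδ hκ)).exists
  refine hk.not_ge ?_
  simp only [hinner]
  rw [← Finset.mul_sum]
  exact mul_le_mul (ht₂ k) (hsum k) hκ.le measureReal_nonneg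

end OrderedBratteliDiagram.Representation

/-! ### Assembling the characterization. -/

/-- The gcd grows with p_n, so the quotient is a non-increasing sequence of naturals and stays at
its minimum once that is reached. -/
theorem exists_eventually_div_gcd_eq (b : ℕ) (q : ℕ → ℕ) :
    ∃ r, ∀ᶠ n in atTop, b / b.gcd (pSeq q n) = r := by
  refine ⟨_, eventually_atTop.2 ⟨Function.argmin fun n => b / b.gcd (pSeq q n), fun n hn =>
    le_antisymm ?_ (Function.argmin_le (fun n => b / b.gcd (pSeq q n)) n)⟩⟩
  rcases Nat.eq_zero_or_pos b with rfl | hb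
  · simp
  · exact Nat.div_le_div_left (Nat.le_of_dvd (Nat.gcd_pos_of_pos_left _ hb)
      (Nat.gcd_dvd_gcd_of_dvd_right _ (OrderedBratteliDiagram.pSeq_dvd q hn)))
      (Nat.gcd_pos_of_pos_left _ hb)

theorem mainTheorem1 {X : Type*} [TopologicalSpace X] [CompactSpace X] [T2Space X]
    [MeasurableSpace X] [BorelSpace X] (hX : IsCantor X)
    (T : X ≃ₜ X) (hT : IsMinimalSystem T)
    (B : OrderedBratteliDiagram) (R : B.Representation T)
    (d : ℕ) (hproper : B.IsProper d)
    (q : ℕ → ℕ) (htoeplitz : B.IsToeplitz q)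
    (vtx : ∀ n, 2 ≤ n → Fin d ≃ B.V n)
    (I : Measure X → Set (Fin d)) (hclean : R.IsClean vtx I)
    (μ : Measure X) [IsProbabilityMeasure μ] (hμ : Ergodic T μ)
    (a : ℤ) (b : ℕ) (hb : 0 < b) (hab : IsCoprime a (b : ℤ))
    (lam : ℂ) (hlam : lam = Complex.exp (2 * Real.pi * Complex.I * ((a : ℂ) / (b : ℂ)))) :
    IsNonContinuousEigenvalue T μ lam ↔
      (∃ bb : ℕ, 1 < bb ∧ bb ≤ d ∧ ∀ᶠ n in atTop, b / Nat.gcd b (pSeq q n) = bb) ∧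
      ∀ t₂ ∈ I μ, ∀ ε : ℝ, 0 < ε → ∃ N : ℕ, ∀ m n : ℕ, N ≤ m → m < n → ∀ hn : 2 ≤ n,
        |(∑ t₁ : B.V m,
            ‖∑ᶠ s ∈ B.suffixSet m n t₁ (vtx n hn t₂), lam ^ (-((pSeq q m * s : ℕ) : ℤ))‖ /
              (qProd q m n : ℝ)) - 1| < ε := by
  have hprim : IsPrimitiveRoot lam b := by
    rw [hlam]
    exact Complex.isPrimitiveRoot_exp_of_isCoprime a b hb.ne' hab
  have hlam1 : ‖lam‖ = 1 := hprim.norm'_eq_one hb.ne'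
  have hmp : MeasurePreserving T μ μ := hμ.toMeasurePreserving
  have : Nonempty X := hX.nonempty
  obtain ⟨S, hScount, hSbasis, -⟩ := hX.exists_basis
  have : SecondCountableTopology X := hSbasis.secondCountableTopology hScount
  have : TopologicalSpace.MetrizableSpace X :=
    TopologicalSpace.metrizableSpace_of_t3_secondCountable X
  obtain ⟨x₀⟩ := hX.nonempty
  obtain ⟨δ, hδ, hclean', -⟩ := hclean
  obtain ⟨hIδ, hI0⟩ := hclean' μ inferInstance hμ
  rw [IsNonContinuousEigenvalue,
    R.isContinuousEigenvalue_iff hT hproper.h4 htoeplitz hb hprim]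
  constructor
  · rintro ⟨heig, hnc⟩
    push Not at hnc
    obtain ⟨f, hfm, hf, hf1, hfT⟩ := heig.exists_norm_eq_one hμ hlam1
    refine ⟨?_, fun t₂ ht₂ ε hε => ?_⟩
    · obtain ⟨r, hr⟩ := exists_eventually_div_gcd_eq b q
      refine ⟨r, ?_, ?_, hr⟩
      · obtain ⟨n, hn⟩ := hr.exists
        by_contra! hle
        have hgb : b.gcd (pSeq q n) ∣ b := Nat.gcd_dvd_left _ _
        have hmul := Nat.div_mul_cancel hgb
        rw [hn] at hmul
        have hr1 : r = 1 := by
          rcases Nat.eq_zero_or_pos r with rfl | h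
          · omega
          · omega
        rw [hr1, one_mul] at hmul
        exact hnc n (hmul ▸ Nat.gcd_dvd_right b (pSeq q n))
      · obtain ⟨n, ⟨hn1, hn2⟩, hn3⟩ := ((hr.and (R.eventually_div_gcd_le_card htoeplitz hmp hb hprim
          hfm hf hf1 hfT)).and (eventually_ge_atTop 2)).exists
        rw [← hn1, ← hproper.h3 n hn3, Nat.card_eq_fintype_card]
        exact hn2
    -- The conjugate eigenfunction belongs to λ⁻¹, which produces the negative exponents of the
    -- sums.
    · have hfm' : Measurable fun x => star (f x) := continuous_star.measurable.comp hfm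
      have hf1' : ∀ᵐ x ∂μ, ‖star (f x)‖ = 1 := by simpa using hf1
      obtain ⟨M, hM⟩ := R.exists_forall_sum_norm_ge htoeplitz hmp (lam := lam⁻¹)
        (by rw [norm_inv, hlam1, inv_one]) hfm'
        (Integrable.of_bound hfm'.aestronglyMeasurable 1 (hf1'.mono fun x hx => hx.le)) hf1'
        (by
          filter_upwards [hfT] with x hx
          rw [hx, star_mul', Complex.inv_eq_conj hlam1]
          -- Towers in `I μ` have mass at least δ, so this error divided by the mass stays below ε.
          rfl) (ε := ε * δ / 2) (by positivity)
      refine ⟨M, fun m n hm hmn hn => ?_⟩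
      have h1 := hM m n hm hmn.le (vtx n hn t₂)
      have h2 := hIδ t₂ ht₂ n hn
      have hQ : (0 : ℝ) < qProd q m n := Nat.cast_pos.2 ((Nat.zero_le _).trans_lt
        (OrderedBratteliDiagram.suffix_lt htoeplitz hmn.le (R.conj x₀)))
      have h3 :=
        OrderedBratteliDiagram.sum_norm_suffixSet_le htoeplitz hmn.le (vtx n hn t₂)
        (w := fun s => lam ^ (-((pSeq q m * s : ℕ) : ℤ))) fun s => by
          rw [norm_zpow, hlam1, one_zpow]
      rw [← div_le_one hQ, Finset.sum_div] at h3
      have hw : ∀ s : ℕ, lam⁻¹ ^ (pSeq q m * s) = lam ^ (-((pSeq q m * s : ℕ) : ℤ)) := fun s => by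
        rw [zpow_neg, zpow_natCast, inv_pow]
      simp only [hw] at h1
      set P := μ.real {x | B.tau n (R.conj x) = vtx n hn t₂}
      set A := ∑ t₁ : B.V m, ‖∑ᶠ s ∈ B.suffixSet m n t₁ (vtx n hn t₂),
        lam ^ (-((pSeq q m * s : ℕ) : ℤ))‖ / (qProd q m n : ℝ)
      rw [abs_sub_lt_iff]
      refine ⟨by linarith, ?_⟩
      by_contra! hcon
      have h4 : δ * ε ≤ P * (1 - A) := mul_le_mul h2 hcon hε.le measureReal_nonneg
      have h5 : 0 < δ * ε := mul_pos hδ hε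
      linarith
  · rintro ⟨⟨bb, hbb1, -, hbb⟩, hsum⟩
    refine ⟨?_, ?_⟩
    · have hiso : ∀ x : B.PathSpace, ¬ IsOpen ({x} : Set B.PathSpace) := fun x => by
        rw [R.isOpen_singleton_iff]
        exact hX.no_isolated _
      -- Otherwise the measures of all `d` towers would tend to 0, although they cover the space.
      obtain ⟨t₂, ht₂⟩ : (I μ).Nonempty := by
        by_contra! hempty
        have h1 : Tendsto (fun n => ∑ t : Fin d, μ.real {x | B.tau (n + 2) (R.conj x) =
            vtx (n + 2) (Nat.le_add_left 2 n) t}) atTop (𝓝 0) := by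
          have := tendsto_finsetSum Finset.univ fun t _ => hI0 t (by simp [hempty])
          simpa using this
        obtain ⟨n, hn⟩ := (h1.eventually_lt_const one_pos).exists
        refine hn.not_ge ?_
        rw [← probReal_univ (μ := μ)]
        refine (measureReal_mono (fun x _ => ?_) (measure_ne_top μ _)).trans
          (measureReal_biUnion_finset_le Finset.univ _)
        simp only [Finset.mem_univ, Set.iUnion_true, Set.mem_iUnion]
        exact ⟨(vtx (n + 2) (Nat.le_add_left 2 n)).symm (B.tau (n + 2) (R.conj x)), by
          simp⟩
      -- A lower bound 1/2 for one fixed m = N and n → ∞ is enough.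
      obtain ⟨N, hN⟩ := hsum t₂ ht₂ (1 / 2) (by norm_num)
      refine R.isMeasurableEigenvalue_of_le_sum htoeplitz hmp
        (OrderedBratteliDiagram.tendsto_pSeq htoeplitz (R.conj x₀) hproper.h2 hiso) hlam1 (m := N)
        (n := fun k => k + (N + 2)) (fun k => by omega) (tendsto_add_atTop_nat _)
        (fun k => vtx _ (by omega) t₂) hδ (κ := 1 / 2) (by norm_num)
        (fun k => hIδ t₂ ht₂ _ _) fun k => ?_
      have h := (abs_sub_lt_iff.1 (hN N (k + (N + 2)) le_rfl (by omega) (by omega))).2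
      linarith
    -- If b divided p_n it would divide all later p_k, making the eventual quotient 1.
    · rintro ⟨n, hn⟩
      obtain ⟨k, hk1, hk2⟩ := (hbb.and (eventually_ge_atTop n)).exists
      rw [Nat.gcd_eq_left (hn.trans (OrderedBratteliDiagram.pSeq_dvd q hk2)), Nat.div_self hb] at hk1
      omega
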